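/- Let $M$ be a smooth manifold of dimension $n\ge 3$ with a conformal structure $\boldsymbol c$, i.e. a class $\{e^{2\phi}g : \phi\in C^\infty(M)\}$ of pseudo-Riemannian metrics (of any signature); for a pseudo-Riemannian manifold $(M,g)$ take $\boldsymbol c=[g]$. Let $\mathcal T\to M$ be the standard conformal tractor bundle of $(M,\boldsymbol c)$. A metric $g\in\boldsymbol c$ trivialises the density bundles $\mathcal E[w]$ and splits $\mathcal T\cong\mathcal E[1]\oplus TM[-1]\oplus\mathcal E[-1]$, with elements $(\sigma,\mu^a,\rho)=\sigma Y+\mu^aZ_a+\rho X$; under $\hat g=e^{2\phi}g$, $\Upsilon=d\phi$, one has $\hat\sigma=\sigma$, $\hat\mu^a=\mu^a+\Upsilon^a\sigma$, $\hat\rho=\rho-\Upsilon_a\mu^a-\tfrac12\Upsilon_a\Upsilon^a\sigma$. The tractor metric is $h(V,V)=2\sigma\rho+g_{ab}\mu^a\mu^b$, the canonical tractor is the inclusion $X:\mathcal E[-1]\to\mathcal T$, $\rho\mapsto(0,0,\rho)$, and the tractor connection is $$\nabla_a(\sigma,\mu^b,\rho)=\bigl(\nabla_a\sigma-\mu_a,\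 \nabla_a\mu^b+\rho\,\delta_a{}^b+P_a{}^b\sigma,\ \nabla_a\rho-P_{ab}\mu^b\bigr),$$ where $\nabla$ is the Levi-Civita connection and $P_{ab}$ the Schouten tensor of $g$. A 2-tractor along a curve $\gamma$ is a smooth section of $\Lambda^2\mathcal T|_\gamma$. Let $\gamma$ be an oriented curve in $M$: a connected, smoothly embedded 1-dimensional submanifold with a chosen orientation. It is an unparametrised oriented null geodesic of $g\in\boldsymbol c$ if it admits a smooth nowhere vanishing tangent field $u$ along all of $\gamma$, compatible with the orientation, with $g(u,u)=0$ and $\nabla_uu=0$. Let $g\in\boldsymbol c$. Then: 1. $\gamma$ is an unparametrised oriented null geodesic of $g$ if and only if there is a 2-tractor $\Sigma\neq0$ along $\gamma$ that is parallel for the tractor connection and satisfies $X\wedge\Sigma=0$. 2. Suppose $\gamma$ is an unparametrised oriented null geodesic. Then every parallel $\Sigma\ne0$ with $X\wedge\Sigma=0$ is totally null, i.e. $\Sigma^A{}_B\Sigma^B{}_C=0$ (indices lowered with $h$), and either $\Sigma$ or $-\Sigma$ is compatible with the orientation of $\gamma$, meaning that at each point it is a positive multiple of $X\wedge Z_au^a$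 for an oriented tangent vector $u^a$ of $\gamma$. A parallel $\Sigma\neq 0$ with $X\wedge\Sigma=0$ that is compatible with the orientation exists, and it is unique up to multiplication by a positive constant. -/

import Mathlib

open scoped Manifold ContDiff

set_option maxSynthPendingDepth 3

noncomputable section

namespace ConformalTractor

/-! ### Pseudo-Riemannian metrics and conformal structures

`M` is a smooth manifold without boundary, modelled on the finite-dimensional real vector
space `E`. -/

/-- A smooth pseudo-Riemannian metric on `M` (of any signature): a smooth section of
`T*M ⊗ T*M` which is symmetric and nondegenerate at every point. -/
structure PseudoRiemannianMetric (E : Type*) [NormedAddCommGroup E] [NormedSpace ℝ E]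
    (M : Type*) [TopologicalSpace M] [ChartedSpace E M] [IsManifold 𝓘(ℝ, E) ∞ M] where
  val (x : M) : TangentSpace 𝓘(ℝ, E) x →L[ℝ] TangentSpace 𝓘(ℝ, E) x →L[ℝ] ℝ
  symm (x : M) (v w : TangentSpace 𝓘(ℝ, E) x) : val x v w = val x w v
  nondegenerate (x : M) (v : TangentSpace 𝓘(ℝ, E) x) (h : ∀ w, val x v w = 0) : v = 0
  contMDiff : ContMDiff 𝓘(ℝ, E) (𝓘(ℝ, E).prod 𝓘(ℝ, E →L[ℝ] E →L[ℝ] ℝ)) ∞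
    (fun x ↦ Bundle.TotalSpace.mk' (E →L[ℝ] E →L[ℝ] ℝ)
      (E := fun x : M ↦ TangentSpace 𝓘(ℝ, E) x →L[ℝ] TangentSpace 𝓘(ℝ, E) x →L[ℝ] ℝ) x (val x))

section

variable {E : Type*} [NormedAddCommGroup E] [NormedSpace ℝ E]
  {M : Type*} [TopologicalSpace M] [ChartedSpace E M] [IsManifold 𝓘(ℝ, E) ∞ M]

/-- `ĝ = e^{2φ} g` with `φ` smooth. -/
def IsRescaling (φ : M → ℝ) (g ĝ : PseudoRiemannianMetric E M) : Prop :=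
  ContMDiff 𝓘(ℝ, E) 𝓘(ℝ, ℝ) ∞ φ ∧
    ∀ (x : M) (v w : TangentSpace 𝓘(ℝ, E) x), ĝ.val x v w = Real.exp (2 * φ x) * g.val x v w

end

/-- A conformal structure on `M`: a full equivalence class of conformally related metrics. -/
structure ConformalStructure (E : Type*) [NormedAddCommGroup E] [NormedSpace ℝ E]
    (M : Type*) [TopologicalSpace M] [ChartedSpace E M] [IsManifold 𝓘(ℝ, E) ∞ M] where
  metrics : Set (PseudoRiemannianMetric E M)
  nonempty : metrics.Nonempty
  related : ∀ g ∈ metrics, ∀ ĝ ∈ metrics, ∃ φ : M → ℝ, IsRescaling φ g ĝ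
  rescale_mem : ∀ g ∈ metrics, ∀ (φ : M → ℝ) (ĝ : PseudoRiemannianMetric E M),
    IsRescaling φ g ĝ → ĝ ∈ metrics

section

variable {E : Type*} [NormedAddCommGroup E] [NormedSpace ℝ E]
  {M : Type*} [TopologicalSpace M] [ChartedSpace E M] [IsManifold 𝓘(ℝ, E) ∞ M]

/-- The conformal class `[g]` of a pseudo-Riemannian manifold `(M, g)`. -/
def PseudoRiemannianMetric.conformalClass (g : PseudoRiemannianMetric E M) :
    ConformalStructure E M where
  metrics := {ĝ | ∃ φ : M → ℝ, IsRescaling φ g ĝ}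
  nonempty := ⟨g, fun _ ↦ 0, contMDiff_const, fun x v w ↦ by simp⟩
  related := by
    rintro g₁ ⟨φ₁, hs₁, h₁⟩ g₂ ⟨φ₂, hs₂, h₂⟩
    refine ⟨fun x ↦ φ₂ x - φ₁ x, hs₂.sub hs₁, fun x v w ↦ ?_⟩
    rw [h₁, h₂, ← mul_assoc, ← Real.exp_add]
    ring_nf
  rescale_mem := by
    rintro g₁ ⟨φ₁, hs₁, h₁⟩ φ₂ g₂ ⟨hs₂, h₂⟩
    refine ⟨fun x ↦ φ₂ x + φ₁ x, hs₂.add hs₁, fun x v w ↦ ?_⟩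
    rw [h₂, h₁, ← mul_assoc, ← Real.exp_add]
    ring_nf

/-! ### Levi-Civita connection and Schouten tensor, in charts

All quantities are computed in the preferred chart at a base point `x₀`; `y : E` denotes the
coordinate of a point in that chart. -/

namespace PseudoRiemannianMetric

variable (g : PseudoRiemannianMetric E M) (x₀ : M) (y : E)

/-- The coordinate matrix `g_{ab}(y)`: the pullback of the metric by the inverse chart. -/
def coordMetric : E →L[ℝ] E →L[ℝ] ℝ :=
  let x : M := (extChartAt 𝓘(ℝ, E) x₀).symm y
  let D : E →L[ℝ] TangentSpace 𝓘(ℝ, E) x :=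
    mfderiv 𝓘(ℝ, E) 𝓘(ℝ, E) (extChartAt 𝓘(ℝ, E) x₀).symm y
  (ContinuousLinearMap.precomp ℝ D) ∘L (g.val x) ∘L D

/-- The inverse metric `g^{ab}(y)`, as the map raising an index. -/
def coordSharp : (E →L[ℝ] ℝ) →L[ℝ] E :=
  ContinuousLinearMap.inverse (g.coordMetric x₀ y)

/-- The Christoffel symbols of the first kind:
`(v, w, z) ↦ ½ (∂_v g(w, z) + ∂_w g(v, z) - ∂_z g(v, w))`. -/
def christoffelLower : E →L[ℝ] E →L[ℝ] E →L[ℝ] ℝ :=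
  let D : E →L[ℝ] E →L[ℝ] E →L[ℝ] ℝ := fderiv ℝ (g.coordMetric x₀) y
  let F : (E →L[ℝ] E →L[ℝ] ℝ) →L[ℝ] (E →L[ℝ] E →L[ℝ] ℝ) :=
    (ContinuousLinearMap.flipₗᵢ ℝ E E ℝ).toContinuousLinearEquiv
  let C : E →L[ℝ] E →L[ℝ] E →L[ℝ] ℝ := F ∘L D.flip
  (1 / 2 : ℝ) • (D + D.flip - C)

theorem christoffelLower_apply (v w z : E) :
    g.christoffelLower x₀ y v w z = (1 / 2 : ℝ) *
      (fderiv ℝ (g.coordMetric x₀) y v w z + fderiv ℝ (g.coordMetric x₀) y w v z -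
        fderiv ℝ (g.coordMetric x₀) y z v w) := rfl

/-- The Christoffel symbols `Γ(v, w)` of the Levi-Civita connection `∇_v w = ∂_v w + Γ(v, w)`. -/
def christoffel : E →L[ℝ] E →L[ℝ] E :=
  (ContinuousLinearMap.compL ℝ E (E →L[ℝ] ℝ) E (g.coordSharp x₀ y)) ∘L g.christoffelLower x₀ y

/-- The curvature, as the endomorphism
`v ↦ R(v, w) z = ∂_v Γ(w, z) - ∂_w Γ(v, z) + Γ(v, Γ(w, z)) - Γ(w, Γ(v, z))`. -/
def curvature (w z : E) : E →L[ℝ] E :=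
  let Γ : E →L[ℝ] E →L[ℝ] E := g.christoffel x₀ y
  let DΓ : E →L[ℝ] E →L[ℝ] E →L[ℝ] E := fderiv ℝ (g.christoffel x₀) y
  (DΓ.flip w).flip z - (DΓ w).flip z + Γ.flip (Γ w z) - (Γ w) ∘L (Γ.flip z)

theorem curvature_apply (v w z : E) :
    g.curvature x₀ y w z v =
      fderiv ℝ (g.christoffel x₀) y v w z - fderiv ℝ (g.christoffel x₀) y w v z +
        g.christoffel x₀ y v (g.christoffel x₀ y w z) -
        g.christoffel x₀ y w (g.christoffel x₀ y v z) := rfl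

theorem curvature_add_left (w w' z : E) :
    g.curvature x₀ y (w + w') z = g.curvature x₀ y w z + g.curvature x₀ y w' z := by
  ext v
  simp only [curvature_apply, map_add, add_apply]
  abel

theorem curvature_smul_left (r : ℝ) (w z : E) :
    g.curvature x₀ y (r • w) z = r • g.curvature x₀ y w z := by
  ext v
  simp only [curvature_apply, map_smul, smul_apply, smul_sub, smul_add]

theorem curvature_add_right (w z z' : E) :
    g.curvature x₀ y w (z + z') = g.curvature x₀ y w z + g.curvature x₀ y w z' := by
  ext v
  simp only [curvature_apply, map_add, add_apply]
  abel

theorem curvature_smul_right (r : ℝ) (w z : E) :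
    g.curvature x₀ y w (r • z) = r • g.curvature x₀ y w z := by
  ext v
  simp only [curvature_apply, map_smul, smul_apply, smul_sub, smul_add]

/-- The Ricci tensor `Ric(w, z) = tr (v ↦ R(v, w) z)`. -/
def ricci : E →ₗ[ℝ] E →ₗ[ℝ] ℝ :=
  LinearMap.mk₂ ℝ (fun w z ↦ LinearMap.trace ℝ E (g.curvature x₀ y w z : E →ₗ[ℝ] E))
    (fun _ _ _ ↦ by simp only [curvature_add_left, ContinuousLinearMap.toLinearMap_add, map_add])
    (fun _ _ _ ↦ by simp only [curvature_smul_left, ContinuousLinearMap.toLinearMap_smul, map_smul])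
    (fun _ _ _ ↦ by simp only [curvature_add_right, ContinuousLinearMap.toLinearMap_add, map_add])
    (fun _ _ _ ↦ by simp only [curvature_smul_right, ContinuousLinearMap.toLinearMap_smul, map_smul])

variable [FiniteDimensional ℝ E]

/-- Raising the second index of a bilinear form: `B_{ab} ↦ B_a{}^b = B_{ac} g^{cb}`. -/
def raise (B : E →ₗ[ℝ] E →ₗ[ℝ] ℝ) : E →ₗ[ℝ] E :=
  (g.coordSharp x₀ y : (E →L[ℝ] ℝ) →ₗ[ℝ] E) ∘ₗ
    (LinearMap.toContinuousLinearMap : (E →ₗ[ℝ] ℝ) ≃ₗ[ℝ] (E →L[ℝ] ℝ)).toLinearMap ∘ₗ B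

/-- The scalar curvature `g^{ab} Ric_{ab}`. -/
def scalarCurvature : ℝ :=
  LinearMap.trace ℝ E (g.raise x₀ y (g.ricci x₀ y))

/-- The conformal Schouten tensor `P = (Ric - Sc / (2 (n - 1)) g) / (n - 2)`, where
`n = dim M ≥ 3`. -/
def schouten : E →ₗ[ℝ] E →ₗ[ℝ] ℝ :=
  let n : ℝ := Module.finrank ℝ E
  (n - 2)⁻¹ • (g.ricci x₀ y - (g.scalarCurvature x₀ y / (2 * (n - 1))) •
    (ContinuousLinearMap.coeLM ℝ).comp (g.coordMetric x₀ y : E →ₗ[ℝ] E →L[ℝ] ℝ))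

end PseudoRiemannianMetric

/-! ### Densities, tractors and 2-tractors

A metric `g ∈ c` trivialises the density bundles (by the powers of its volume density) and splits
the standard tractor bundle as `𝓔[1] ⊕ TM[-1] ⊕ 𝓔[-1]`. An element of a fibre is thus a family of
components, one for each `g ∈ c`, obeying the transformation law under `ĝ = e^{2φ} g`. -/

/-- The fibre at `x` of the bundle `𝓔[w]` of conformal densities of weight `w`:
`τ_ĝ = e^{wφ} τ_g` when `ĝ = e^{2φ} g`. -/
def densityFibre (c : ConformalStructure E M) (w : ℝ) (x : M) : Submodule ℝ (c.metrics → ℝ) where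
  carrier := {τ | ∀ (g ĝ : c.metrics) (φ : M → ℝ), IsRescaling φ g.1 ĝ.1 →
    τ ĝ = Real.exp (w * φ x) * τ g}
  zero_mem' := fun _ _ _ _ ↦ by simp
  add_mem' := fun ha hb g ĝ φ h ↦ by simp only [Pi.add_apply, ha g ĝ φ h, hb g ĝ φ h, mul_add]
  smul_mem' := fun r τ ha g ĝ φ h ↦ by
    simp only [Pi.smul_apply, smul_eq_mul, ha g ĝ φ h]; ring

/-- The components `(σ, μ^a, ρ)` of a standard tractor `V = σ Y + μ^a Z_a + ρ X` at `x` in the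
splitting given by a metric `g`, with the densities trivialised by `g`. -/
abbrev SplitTractor (E : Type*) [NormedAddCommGroup E] [NormedSpace ℝ E]
    {M : Type*} [TopologicalSpace M] [ChartedSpace E M] (x : M) : Type _ :=
  ℝ × TangentSpace 𝓘(ℝ, E) x × ℝ

/-- The gradient `Υ^a = g^{ab} ∇_b φ`. -/
def PseudoRiemannianMetric.grad (g : PseudoRiemannianMetric E M) (φ : M → ℝ) (x : M) :
    TangentSpace 𝓘(ℝ, E) x :=
  ContinuousLinearMap.inverse (g.val x) (mvfderiv 𝓘(ℝ, E) φ x)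

/-- The change of tractor components from `g` to `ĝ = e^{2φ} g`. With `Υ = dφ`, as densities
`σ̂ = σ`, `μ̂^a = μ^a + Υ^a σ`, `ρ̂ = ρ - Υ_a μ^a - ½ Υ_a Υ^a σ`; the exponential factors come from
the weights `1`, `-1`, `-1`. -/
def changeSplitting (g : PseudoRiemannianMetric E M) (φ : M → ℝ) (x : M) :
    SplitTractor E x →ₗ[ℝ] SplitTractor E x where
  toFun V :=
    (Real.exp (φ x) * V.1,
      Real.exp (-φ x) • (V.2.1 + V.1 • g.grad φ x),
      Real.exp (-φ x) * (V.2.2 - mvfderiv 𝓘(ℝ, E) φ x V.2.1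
        - 1 / 2 * mvfderiv 𝓘(ℝ, E) φ x (g.grad φ x) * V.1))
  map_add' V W := by
    refine Prod.ext ?_ (Prod.ext ?_ ?_)
    · simp only [Prod.fst_add]; ring
    · simp only [Prod.fst_add, Prod.snd_add, add_smul, smul_add]; abel
    · simp only [Prod.fst_add, Prod.snd_add, map_add]; ring
  map_smul' r V := by
    refine Prod.ext ?_ (Prod.ext ?_ ?_)
    · simp only [Prod.smul_fst, smul_eq_mul, RingHom.id_apply]; ring
    · simp only [Prod.smul_fst, Prod.smul_snd, RingHom.id_apply, smul_eq_mul, smul_add,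
        smul_smul]
      ring_nf
    · simp only [Prod.smul_fst, Prod.smul_snd, map_smul, RingHom.id_apply, smul_eq_mul]; ring

/-- The fibre `𝓣_x` of the standard conformal tractor bundle. -/
def tractorFibre (c : ConformalStructure E M) (x : M) :
    Submodule ℝ (c.metrics → SplitTractor E x) where
  carrier := {V | ∀ (g ĝ : c.metrics) (φ : M → ℝ), IsRescaling φ g.1 ĝ.1 →
    V ĝ = changeSplitting g.1 φ x (V g)}
  zero_mem' := fun _ _ _ _ ↦ by simp
  add_mem' := fun ha hb g ĝ φ h ↦ by simp only [Pi.add_apply, ha g ĝ φ h, hb g ĝ φ h, map_add]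
  smul_mem' := fun r τ ha g ĝ φ h ↦ by simp only [Pi.smul_apply, ha g ĝ φ h, map_smul]

/-- The components of a tractor in the splitting given by `g ∈ c`. -/
def split (c : ConformalStructure E M) (g : c.metrics) (x : M) :
    tractorFibre c x →ₗ[ℝ] SplitTractor E x :=
  (LinearMap.proj g) ∘ₗ (tractorFibre c x).subtype

/-- The canonical tractor, as the bundle map `X : 𝓔[-1] → 𝓣`, `ρ ↦ (0, 0, ρ)`. -/
def canonicalTractor (c : ConformalStructure E M) (x : M) :
    densityFibre c (-1) x →ₗ[ℝ] tractorFibre c x where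
  toFun ρ := ⟨fun g ↦ (0, 0, ρ.1 g), fun g ĝ φ h ↦ by
    simp [changeSplitting, ρ.2 g ĝ φ h]⟩
  map_add' ρ τ := by
    apply Subtype.ext; funext g; simp
  map_smul' r τ := by
    apply Subtype.ext; funext g; simp

/-- The tractor metric in the splitting given by `g`, polarising `2 σ ρ + g_{ab} μ^a μ^b`. -/
def splitMetric (g : PseudoRiemannianMetric E M) (x : M) :
    SplitTractor E x →ₗ[ℝ] SplitTractor E x →ₗ[ℝ] ℝ :=
  LinearMap.mk₂ ℝ (fun V W ↦ V.1 * W.2.2 + V.2.2 * W.1 + g.val x V.2.1 W.2.1)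
    (fun _ _ _ ↦ by
      simp only [Prod.fst_add, Prod.snd_add, map_add, add_apply]; ring)
    (fun _ _ _ ↦ by
      simp only [Prod.smul_fst, Prod.smul_snd, map_smul, smul_apply, smul_eq_mul]; ring)
    (fun _ _ _ ↦ by
      simp only [Prod.fst_add, Prod.snd_add, map_add]; ring)
    (fun _ _ _ ↦ by
      simp only [Prod.smul_fst, Prod.smul_snd, map_smul, smul_eq_mul]; ring)

/-- The tractor metric `h` on `𝓣_x`. It is computed in the splitting of some `g ∈ c`; it does not
depend on which one, see `tractorMetric_eq`. -/
def tractorMetric (c : ConformalStructure E M) (x : M) :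
    tractorFibre c x →ₗ[ℝ] tractorFibre c x →ₗ[ℝ] ℝ :=
  let g : c.metrics := ⟨c.nonempty.some, c.nonempty.some_mem⟩
  (splitMetric g.1 x).compl₁₂ (split c g x) (split c g x)

theorem PseudoRiemannianMetric.val_grad [FiniteDimensional ℝ E] (g : PseudoRiemannianMetric E M)
    (φ : M → ℝ) (x : M) (w : TangentSpace 𝓘(ℝ, E) x) :
    g.val x (g.grad φ x) w = mvfderiv 𝓘(ℝ, E) φ x w := by
  have key : ∀ (B : E →L[ℝ] E →L[ℝ] ℝ) (_ : ∀ v, (∀ w, B v w = 0) → v = 0) (l : E →L[ℝ] ℝ),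
      B (ContinuousLinearMap.inverse B l) = l := by
    intro B hB l
    have inj : Function.Injective (B : E →ₗ[ℝ] E →L[ℝ] ℝ) := by
      rw [injective_iff_map_eq_zero]
      exact fun v hv ↦ hB v fun w ↦ by
        have h : B v = 0 := hv
        rw [h]; rfl
    have hdim : Module.finrank ℝ E = Module.finrank ℝ (E →L[ℝ] ℝ) :=
      (Subspace.dual_finrank_eq (K := ℝ) (V := E)).symm.trans
        (LinearMap.toContinuousLinearMap : (E →ₗ[ℝ] ℝ) ≃ₗ[ℝ] (E →L[ℝ] ℝ)).finrank_eq
    have : B.IsInvertible :=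
      ⟨(LinearEquiv.ofInjectiveOfFinrankEq (B : E →ₗ[ℝ] E →L[ℝ] ℝ) inj
        hdim).toContinuousLinearEquiv, by ext; rfl⟩
    exact this.self_apply_inverse l
  exact congrArg (fun l : E →L[ℝ] ℝ ↦ l w) (key (g.val x) (g.nondegenerate x) _)

theorem tractorMetric_eq [FiniteDimensional ℝ E] (c : ConformalStructure E M) (x : M)
    (g : c.metrics) (V W : tractorFibre c x) :
    tractorMetric c x V W = splitMetric g.1 x (split c g x V) (split c g x W) := by
  have key : ∀ g₁ g₂ : c.metrics, splitMetric g₂.1 x (split c g₂ x V) (split c g₂ x W) =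
      splitMetric g₁.1 x (split c g₁ x V) (split c g₁ x W) := by
    intro g₁ g₂
    obtain ⟨φ, hφ⟩ := c.related g₁.1 g₁.2 g₂.1 g₂.2
    have hV : split c g₂ x V = changeSplitting g₁.1 φ x (split c g₁ x V) := V.2 g₁ g₂ φ hφ
    have hW : split c g₂ x W = changeSplitting g₁.1 φ x (split c g₁ x W) := W.2 g₁ g₂ φ hφ
    rw [hV, hW]
    obtain ⟨a, v, b⟩ := split c g₁ x V
    obtain ⟨a', v', b'⟩ := split c g₁ x W
    have h₁ : g₁.1.val x v (g₁.1.grad φ x) = mvfderiv 𝓘(ℝ, E) φ x v := by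
      rw [g₁.1.symm, g₁.1.val_grad]
    have h₂ : Real.exp (2 * φ x) = Real.exp (φ x) * Real.exp (φ x) := by
      rw [← Real.exp_add]; ring_nf
    simp only [splitMetric, changeSplitting, LinearMap.mk₂_apply, LinearMap.coe_mk,
      AddHom.coe_mk, hφ.2, map_add, map_smul, add_apply, smul_apply,
      smul_eq_mul, g₁.1.val_grad, h₁, h₂, Real.exp_neg]
    field_simp
    ring
  exact key g _

/-- The endomorphism `Σ^A{}_B` of `V` obtained from a bivector `Σ^{AB}` by lowering an index with
the bilinear form `h`: it sends `z` to `h(w, z) v - h(v, z) w` when `Σ = v ∧ w`. -/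
def bivectorEnd {V : Type*} [AddCommGroup V] [Module ℝ V] (h : V →ₗ[ℝ] V →ₗ[ℝ] ℝ) :
    ⋀[ℝ]^2 V →ₗ[ℝ] (V →ₗ[ℝ] V) :=
  exteriorPower.alternatingMapLinearEquiv
    { toFun := fun v ↦ (h (v 1)).smulRight (v 0) - (h (v 0)).smulRight (v 1)
      map_update_add' := by
        intro _ m i x y
        fin_cases i <;> ext z <;> simp [Function.update, add_smul, smul_add] <;> abel
      map_update_smul' := by
        intro _ m i r x
        fin_cases i <;> ext z <;>
          simp [Function.update, smul_sub, smul_smul, mul_comm]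
      map_eq_zero_of_eq' := by
        intro v i j hv hij
        have h01 : v 0 = v 1 := by
          fin_cases i <;> fin_cases j <;> simp_all
        rw [h01, sub_self] }

theorem bivectorEnd_wedge {V : Type*} [AddCommGroup V] [Module ℝ V] (h : V →ₗ[ℝ] V →ₗ[ℝ] ℝ)
    (v w z : V) :
    bivectorEnd h (exteriorPower.ιMulti ℝ 2 ![v, w]) z = h w z • v - h v z • w := by
  simp [bivectorEnd]

/-! ### Curves and null geodesics

A curve is a connected one-dimensional embedded submanifold of `M`, given as a smooth embedding
`γ : N → M` of a connected 1-manifold `N`. -/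

variable {N : Type*} [TopologicalSpace N] [ChartedSpace ℝ N]

/-- A velocity field (equivalently, an orientation) on the 1-manifold `N`: a smooth nowhere
vanishing section of `TN`. -/
def IsVelocityField [IsManifold 𝓘(ℝ, ℝ) ∞ N] (u : ∀ s : N, TangentSpace 𝓘(ℝ, ℝ) s) : Prop :=
  ContMDiff 𝓘(ℝ, ℝ) 𝓘(ℝ, ℝ).tangent ∞ (fun s ↦ (⟨s, u s⟩ : TangentBundle 𝓘(ℝ, ℝ) N)) ∧
    ∀ s, u s ≠ 0

/-- The push-forward of a tangent vector of `N` along `γ`. -/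
def pushforward (γ : N → M) (s : N) :
    TangentSpace 𝓘(ℝ, ℝ) s →L[ℝ] TangentSpace 𝓘(ℝ, E) (γ s) :=
  mfderiv 𝓘(ℝ, ℝ) 𝓘(ℝ, E) γ s

/-- The coordinate expression of tangent vectors at `x` in the preferred chart at `x₀`. -/
def tangentCoord (E : Type*) [NormedAddCommGroup E] [NormedSpace ℝ E]
    {M : Type*} [TopologicalSpace M] [ChartedSpace E M] (x₀ x : M) :
    TangentSpace 𝓘(ℝ, E) x →L[ℝ] E :=
  mvfderiv 𝓘(ℝ, E) (extChartAt 𝓘(ℝ, E) x₀) x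

/-- The covariant derivative `∇_v U` at `s₀`, for the Levi-Civita connection of `g`, of a vector
field `U` along `γ` in the direction of `v ∈ T_{s₀}N`; expressed in the preferred chart at
`γ s₀`. -/
def covDerivAlong (g : PseudoRiemannianMetric E M) (γ : N → M)
    (U : ∀ s : N, TangentSpace 𝓘(ℝ, E) (γ s)) (s₀ : N) (v : TangentSpace 𝓘(ℝ, ℝ) s₀) : E :=
  let x₀ := γ s₀
  mvfderiv 𝓘(ℝ, ℝ) (fun s ↦ tangentCoord E x₀ (γ s) (U s)) s₀ v +
    g.christoffel x₀ (extChartAt 𝓘(ℝ, E) x₀ x₀)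
      (tangentCoord E x₀ x₀ (pushforward γ s₀ v)) (tangentCoord E x₀ x₀ (U s₀))

/-- The curve `γ` with the orientation `o` is an unparametrised oriented null geodesic of `g`: it
admits a velocity field `u`, compatible with the orientation, with `g(u, u) = 0` and
`∇_u u = 0`. -/
def IsOrientedNullGeodesic [IsManifold 𝓘(ℝ, ℝ) ∞ N] (g : PseudoRiemannianMetric E M) (γ : N → M)
    (o : ∀ s : N, TangentSpace 𝓘(ℝ, ℝ) s) : Prop :=
  ∃ u : ∀ s : N, TangentSpace 𝓘(ℝ, ℝ) s, IsVelocityField u ∧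
    (∀ s, ∃ r : ℝ, 0 < r ∧ u s = r • o s) ∧
    (∀ s, g.val (γ s) (pushforward γ s (u s)) (pushforward γ s (u s)) = 0) ∧
    (∀ s, covDerivAlong g γ (fun t ↦ pushforward γ t (u t)) s (u s) = 0)

/-! ### 2-tractors along a curve -/

/-- A (not necessarily smooth) section of `Λ²𝓣` along `γ`. -/
abbrev BitractorAlong (c : ConformalStructure E M) (γ : N → M) : Type _ :=
  ∀ s : N, ⋀[ℝ]^2 (tractorFibre c (γ s))

/-- The components of a tractor at `x` in the splitting of `g` and the preferred chart at `x₀`. -/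
def coordSplit (c : ConformalStructure E M) (g : c.metrics) (x₀ x : M) :
    tractorFibre c x →ₗ[ℝ] ℝ × E × ℝ :=
  (LinearMap.id.prodMap ((tangentCoord E x₀ x : TangentSpace 𝓘(ℝ, E) x →ₗ[ℝ] E).prodMap
    LinearMap.id)) ∘ₗ split c g x

/-- The component `B(α, β) = B^{AB} α_A β_B` of a bivector (so `α(v) β(w) - α(w) β(v)` if
`B = v ∧ w`). -/
def bivectorComponent {V : Type*} [AddCommGroup V] [Module ℝ V] (B : ⋀[ℝ]^2 V)
    (α β : Module.Dual ℝ V) : ℝ :=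
  exteriorPower.alternatingMapToDual ℝ V 2 ![α, β] B

/-- The components along `γ` of a 2-tractor in the splitting of `g` and the preferred chart at
`x₀`. -/
def component (c : ConformalStructure E M) (γ : N → M) (S : BitractorAlong c γ) (g : c.metrics)
    (x₀ : M) (α β : Module.Dual ℝ (ℝ × E × ℝ)) (s : N) : ℝ :=
  bivectorComponent (exteriorPower.map 2 (coordSplit c g x₀ (γ s)) (S s)) α β

/-- Smoothness of a section of `Λ²𝓣` along `γ`. -/
def IsSmoothBitractor (c : ConformalStructure E M) (γ : N → M) (S : BitractorAlong c γ) : Prop :=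
  ∀ (g : c.metrics) (s₀ : N) (α β : Module.Dual ℝ (ℝ × E × ℝ)),
    ContMDiffAt 𝓘(ℝ, ℝ) 𝓘(ℝ, ℝ) ∞ (component c γ S g (γ s₀) α β) s₀

variable [FiniteDimensional ℝ E]

/-- The connection form of the tractor connection in the splitting of `g` and the preferred chart
at `x₀`, at the point `x₀`: `∇_u V = ∂_u V + A(u) V`, where, with `V = (σ, μ, ρ)`,
`∇_u V = (∇_u σ - g(u, μ), ∇_u μ + ρ u + σ P(u)^♯, ∇_u ρ - P(u, μ))`. -/
def connectionForm (g : PseudoRiemannianMetric E M) (x₀ : M) (u : E) :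
    (ℝ × E × ℝ) →ₗ[ℝ] (ℝ × E × ℝ) :=
  let y : E := extChartAt 𝓘(ℝ, E) x₀ x₀
  let σ : (ℝ × E × ℝ) →ₗ[ℝ] ℝ := LinearMap.fst ℝ ℝ (E × ℝ)
  let μ : (ℝ × E × ℝ) →ₗ[ℝ] E := LinearMap.fst ℝ E ℝ ∘ₗ LinearMap.snd ℝ ℝ (E × ℝ)
  let ρ : (ℝ × E × ℝ) →ₗ[ℝ] ℝ := LinearMap.snd ℝ E ℝ ∘ₗ LinearMap.snd ℝ ℝ (E × ℝ)
  (-((g.coordMetric x₀ y u : E →ₗ[ℝ] ℝ) ∘ₗ μ)).prod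
    (((g.christoffel x₀ y u : E →ₗ[ℝ] E) ∘ₗ μ + ρ.smulRight u +
        σ.smulRight (g.raise x₀ y (g.schouten x₀ y) u)).prod
      (-(g.schouten x₀ y u ∘ₗ μ)))

/-- The component `(∇_v S)(α, β)` at `s₀` of the covariant derivative of a 2-tractor along `γ` for
the tractor connection (extended to `Λ²𝓣` by the Leibniz rule), in the splitting of `g`. -/
def tractorDerivComponent (c : ConformalStructure E M) (γ : N → M) (S : BitractorAlong c γ)
    (g : c.metrics) (s₀ : N) (v : TangentSpace 𝓘(ℝ, ℝ) s₀)
    (α β : Module.Dual ℝ (ℝ × E × ℝ)) : ℝ :=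
  let x₀ := γ s₀
  let A := connectionForm g.1 x₀ (tangentCoord E x₀ x₀ (pushforward γ s₀ v))
  mvfderiv 𝓘(ℝ, ℝ) (component c γ S g x₀ α β) s₀ v +
    component c γ S g x₀ (α ∘ₗ A) β s₀ + component c γ S g x₀ α (β ∘ₗ A) s₀

/-- `S` is parallel along `γ` for the tractor connection. -/
def IsParallel (c : ConformalStructure E M) (γ : N → M) (S : BitractorAlong c γ) : Prop :=
  ∀ (g : c.metrics) (s₀ : N) (v : TangentSpace 𝓘(ℝ, ℝ) s₀) (α β : Module.Dual ℝ (ℝ × E × ℝ)),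
    tractorDerivComponent c γ S g s₀ v α β = 0

/-- The incidence relation `X ∧ S = 0` along `γ`, where `X : 𝓔[-1] → 𝓣` is the canonical
tractor. -/
def IsIncident (c : ConformalStructure E M) (γ : N → M) (S : BitractorAlong c γ) : Prop :=
  ∀ (s : N) (ρ : densityFibre c (-1) (γ s)),
    ExteriorAlgebra.ι ℝ (canonicalTractor c (γ s) ρ) *
      (S s : ExteriorAlgebra ℝ (tractorFibre c (γ s))) = 0

/-- `S` is totally null: `S^A{}_B S^B{}_C = 0` along `γ`. -/
def IsTotallyNull (c : ConformalStructure E M) (γ : N → M) (S : BitractorAlong c γ) : Prop :=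
  ∀ s : N, bivectorEnd (tractorMetric c (γ s)) (S s) ∘ₗ
    bivectorEnd (tractorMetric c (γ s)) (S s) = 0

/-- `S` is compatible with the orientation `o` of `γ`: at every point it is a positive multiple of
`X ∧ Z_a o^a`, in the splitting of any `g ∈ c`. -/
def IsCompatible (c : ConformalStructure E M) (γ : N → M) (o : ∀ s : N, TangentSpace 𝓘(ℝ, ℝ) s)
    (S : BitractorAlong c γ) : Prop :=
  ∀ (g : c.metrics) (s : N), ∃ r : ℝ, 0 < r ∧
    exteriorPower.map 2 (split c g (γ s)) (S s) =
      r • exteriorPower.ιMulti ℝ 2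
        ![((0, 0, 1) : SplitTractor E (γ s)), (0, pushforward γ s (o s), 0)]

/-- `S` is a smooth, not identically zero, parallel 2-tractor along `γ` with `X ∧ S = 0`. -/
structure IsIncidentParallel (c : ConformalStructure E M) (γ : N → M)
    (S : BitractorAlong c γ) : Prop where
  smooth : IsSmoothBitractor c γ S
  ne_zero : S ≠ 0
  parallel : IsParallel c γ S
  incident : IsIncident c γ S

end

end ConformalTractor

end

noncomputable section

namespace ConformalTractor

open Set Bundle

/-! ### Smoothness of differentials evaluated on vector fields -/

section

variable {E : Type*} [NormedAddCommGroup E] [NormedSpace ℝ E]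
  {M : Type*} [TopologicalSpace M] [ChartedSpace E M] [IsManifold 𝓘(ℝ, E) ∞ M]
  {F : Type*} [NormedAddCommGroup F] [NormedSpace ℝ F]
  {N : Type*} [TopologicalSpace N] [ChartedSpace F N] [IsManifold 𝓘(ℝ, F) ∞ N]
  {G : Type*} [NormedAddCommGroup G] [NormedSpace ℝ G]
  {Q : Type*} [TopologicalSpace Q] [ChartedSpace G Q]

/-! Fix a metric `g` of the class. Incidence makes `Σ` divisible by `X`, so `Σ = X ∧ (σ Y + μ^a
Z_a)`, the `X`-part of the second factor being irrelevant. Since `∇_u X = Z_a u^a`, the components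
of `∇_u Σ` that do not involve `X` are those of `Z_u ∧ (σ Y + Z_μ)`. If `Σ` is parallel they vanish,
which forces `σ = 0` and `μ` proportional to the tangent of the curve
(`IsIncidentParallel.exists_hasLeg`). Hence `Σ = X ∧ Z_V` with `V` tangent to the curve; the
predicate `HasLeg` records this.

For such `Σ` one has `∇_v Σ = X ∧ Z_{∇_v V} + Z_v ∧ Z_V - g(v, V) X ∧ Y`
(`HasLeg.tractorDerivComponent_eq`). The Schouten contribution is a multiple of `X` and is killed by
the wedge; `Z_v ∧ Z_V` vanishes because tangent spaces of the curve are lines. So parallel incident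
2-tractors correspond exactly to smooth tangent fields `V` that are null and satisfy `∇_v V = 0`,
which is `IsNullParallelField`.

The theorem then becomes a set of facts about such fields. A field that is not identically zero
vanishes nowhere, by uniqueness for linear differential equations and connectedness; its sign
relative to the orientation is constant, so `V` or `-V` is an oriented geodesic velocity. Two such
fields, one nowhere zero, differ by a constant factor, since the derivative of the ratio vanishes.
Total nullity holds because `X` and `Z_V` span a totally null plane.

Smoothness and parallelism of `Σ` are required in the splitting of every metric of the class.
Passing to `e^{2φ} g` replaces `V` by `e^{-2φ} V`, and conformal invariance of null geodesics
(`IsNullParallelField.rescale`) says that this field is again null and parallel. -/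

theorem contMDiffAt_mfderiv_apply {f : N → M} {U : Set N} (hU : IsOpen U)
    (hf : ContMDiffOn 𝓘(ℝ, F) 𝓘(ℝ, E) ∞ f U) {b : Q → N}
    {V : ∀ q : Q, TangentSpace 𝓘(ℝ, F) (b q)} {q₀ : Q} (hq₀ : b q₀ ∈ U)
    (hV : ContMDiffAt 𝓘(ℝ, G) 𝓘(ℝ, F).tangent ∞
      (fun q ↦ (⟨b q, V q⟩ : TangentBundle 𝓘(ℝ, F) N)) q₀) :
    ContMDiffAt 𝓘(ℝ, G) 𝓘(ℝ, E).tangent ∞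
      (fun q ↦ (⟨f (b q), mfderiv 𝓘(ℝ, F) 𝓘(ℝ, E) f (b q) (V q)⟩ : TangentBundle 𝓘(ℝ, E) M))
      q₀ := by
  have h := (hf.contMDiffOn_tangentMapWithin (m := ∞) (by simp) hU.uniqueMDiffOn)
    ⟨b q₀, V q₀⟩ hq₀
  have hmem : TotalSpace.proj ⁻¹' U ∈ nhds (⟨b q₀, V q₀⟩ : TangentBundle 𝓘(ℝ, F) N) :=
    (hU.preimage (FiberBundle.continuous_proj F (TangentSpace 𝓘(ℝ, F)))).mem_nhds hq₀
  refine ((h.contMDiffAt hmem).comp q₀ hV).congr_of_eventuallyEq ?_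
  filter_upwards [hV.continuousAt.preimage_mem_nhds hmem] with q hq
  simp only [Function.comp_apply, tangentMapWithin]
  rw [mfderivWithin_of_mem_nhds (hU.mem_nhds hq)]

theorem contMDiffAt_mvfderiv_apply {f : N → E} {U : Set N} (hU : IsOpen U)
    (hf : ContMDiffOn 𝓘(ℝ, F) 𝓘(ℝ, E) ∞ f U) {b : Q → N}
    {V : ∀ q : Q, TangentSpace 𝓘(ℝ, F) (b q)} {q₀ : Q} (hq₀ : b q₀ ∈ U)
    (hV : ContMDiffAt 𝓘(ℝ, G) 𝓘(ℝ, F).tangent ∞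
      (fun q ↦ (⟨b q, V q⟩ : TangentBundle 𝓘(ℝ, F) N)) q₀) :
    ContMDiffAt 𝓘(ℝ, G) 𝓘(ℝ, E) ∞ (fun q ↦ mvfderiv 𝓘(ℝ, F) f (b q) (V q)) q₀ := by
  have h := contMDiffAt_mfderiv_apply hU hf hq₀ hV
  rw [contMDiffAt_totalSpace] at h
  simpa using! h.2

end

/-! ### The metric and its Christoffel symbols in a chart -/

section

variable {E : Type*} [NormedAddCommGroup E] [NormedSpace ℝ E]
  {M : Type*} [TopologicalSpace M] [ChartedSpace E M] [IsManifold 𝓘(ℝ, E) ∞ M]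
  {F : Type*} [NormedAddCommGroup F] [NormedSpace ℝ F]
  {N : Type*} [TopologicalSpace N] [ChartedSpace F N]

theorem contMDiffAt_metric_apply (g : PseudoRiemannianMetric E M) {f : N → M} {s₀ : N}
    {V W : ∀ s : N, TangentSpace 𝓘(ℝ, E) (f s)}
    (hV : ContMDiffAt 𝓘(ℝ, F) 𝓘(ℝ, E).tangent ∞ (fun s ↦ (⟨f s, V s⟩ : TangentBundle 𝓘(ℝ, E) M)) s₀)
    (hW : ContMDiffAt 𝓘(ℝ, F) 𝓘(ℝ, E).tangent ∞
      (fun s ↦ (⟨f s, W s⟩ : TangentBundle 𝓘(ℝ, E) M)) s₀) :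
    ContMDiffAt 𝓘(ℝ, F) 𝓘(ℝ, ℝ) ∞ (fun s ↦ g.val (f s) (V s) (W s)) s₀ := by
  have hb : ContMDiffAt 𝓘(ℝ, F) 𝓘(ℝ, E) ∞ f s₀ := by
    rw [contMDiffAt_totalSpace] at hV
    exact hV.1
  have : ContMDiffAt 𝓘(ℝ, F) (𝓘(ℝ, E).prod 𝓘(ℝ, ℝ)) ∞
      (fun s ↦ TotalSpace.mk' ℝ (E := Bundle.Trivial M ℝ) (f s) (g.val (f s) (V s) (W s))) s₀ := by
    apply ContMDiffAt.clm_bundle_apply₂ (F₁ := E) (F₂ := E)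
    · exact g.contMDiff.contMDiffAt.comp s₀ hb
    · exact hV
    · exact hW
  rw [contMDiffAt_totalSpace] at this
  exact this.2

theorem tangentCoord_mfderiv_symm {x₀ : M} {y : E} (hy : y ∈ (extChartAt 𝓘(ℝ, E) x₀).target)
    (v : E) :
    tangentCoord E x₀ ((extChartAt 𝓘(ℝ, E) x₀).symm y)
      (mfderiv 𝓘(ℝ, E) 𝓘(ℝ, E) (extChartAt 𝓘(ℝ, E) x₀).symm y v) = v := by
  have h := mfderiv_extChartAt_comp_mfderivWithin_extChartAt_symm (I := 𝓘(ℝ, E)) hy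
  rw [modelWithCornersSelf_coe, range_id, mfderivWithin_univ] at h
  exact congrArg (fun l : E →L[ℝ] E ↦ l v) h

theorem mfderiv_symm_tangentCoord {x₀ x : M} (hx : x ∈ (extChartAt 𝓘(ℝ, E) x₀).source)
    (v : TangentSpace 𝓘(ℝ, E) x) :
    (mfderiv 𝓘(ℝ, E) 𝓘(ℝ, E) (extChartAt 𝓘(ℝ, E) x₀).symm (extChartAt 𝓘(ℝ, E) x₀ x)
      (tangentCoord E x₀ x v) : E) = v := by
  have h := mfderivWithin_extChartAt_symm_comp_mfderiv_extChartAt' (I := 𝓘(ℝ, E)) hx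
  rw [modelWithCornersSelf_coe, range_id, mfderivWithin_univ] at h
  exact congrArg (fun l : E →L[ℝ] E ↦ l v) h

theorem tangentCoord_injective {x₀ x : M} (hx : x ∈ (extChartAt 𝓘(ℝ, E) x₀).source) :
    Function.Injective (tangentCoord E x₀ x) := by
  intro v w h
  rw [← mfderiv_symm_tangentCoord hx v, ← mfderiv_symm_tangentCoord hx w, h]

namespace PseudoRiemannianMetric

variable (g : PseudoRiemannianMetric E M) {x₀ : M}

theorem coordMetric_symm (x₀ : M) (y v w : E) :
    g.coordMetric x₀ y v w = g.coordMetric x₀ y w v :=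
  g.symm _ _ _

theorem coordMetric_tangentCoord {x : M} (hx : x ∈ (extChartAt 𝓘(ℝ, E) x₀).source)
    (v w : TangentSpace 𝓘(ℝ, E) x) :
    g.coordMetric x₀ (extChartAt 𝓘(ℝ, E) x₀ x) (tangentCoord E x₀ x v) (tangentCoord E x₀ x w) =
      g.val x v w := by
  -- The two base points agree only propositionally, so both forms are read on the model space `E`,
  -- where they can be compared without transport.
  have h : (g.val ((extChartAt 𝓘(ℝ, E) x₀).symm (extChartAt 𝓘(ℝ, E) x₀ x)) : E →L[ℝ] E →L[ℝ] ℝ) =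
      g.val x := by rw [(extChartAt 𝓘(ℝ, E) x₀).left_inv hx]
  have hv := mfderiv_symm_tangentCoord hx v
  have hw := mfderiv_symm_tangentCoord hx w
  exact (congrArg (fun B : E →L[ℝ] E →L[ℝ] ℝ ↦ B _ _) h).trans
    (congrArg₂ (fun a b : E ↦ (g.val x : E →L[ℝ] E →L[ℝ] ℝ) a b) hv hw)

theorem coordMetric_nondegenerate {y : E} (hy : y ∈ (extChartAt 𝓘(ℝ, E) x₀).target) {v : E}
    (h : ∀ w, g.coordMetric x₀ y v w = 0) : v = 0 := by
  set x := (extChartAt 𝓘(ℝ, E) x₀).symm y with hx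
  have hxs : x ∈ (extChartAt 𝓘(ℝ, E) x₀).source := (extChartAt 𝓘(ℝ, E) x₀).map_target hy
  have hyx : extChartAt 𝓘(ℝ, E) x₀ x = y := (extChartAt 𝓘(ℝ, E) x₀).right_inv hy
  set V : TangentSpace 𝓘(ℝ, E) x := mfderiv 𝓘(ℝ, E) 𝓘(ℝ, E) (extChartAt 𝓘(ℝ, E) x₀).symm y v
  have hV : tangentCoord E x₀ x V = v := tangentCoord_mfderiv_symm hy v
  have : V = 0 := g.nondegenerate x V fun w ↦ by
    rw [← g.coordMetric_tangentCoord hxs, hyx, hV, h]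
  rw [← hV, this, map_zero]

variable [FiniteDimensional ℝ E]

/-- In finite dimension it suffices to evaluate on constant vectors `v`, `w`; their images under the
differential of the inverse chart are smooth fields, on which the metric is smooth. -/
theorem contDiffOn_coordMetric (x₀ : M) :
    ContDiffOn ℝ ∞ (g.coordMetric x₀) (extChartAt 𝓘(ℝ, E) x₀).target := by
  refine contDiffOn_clm_apply.2 fun v ↦ contDiffOn_clm_apply.2 fun w ↦ fun y hy ↦ ?_
  have hsec : ∀ v : E, ContMDiffAt 𝓘(ℝ, E) 𝓘(ℝ, E).tangent ∞
      (fun y ↦ (⟨(extChartAt 𝓘(ℝ, E) x₀).symm y,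
        mfderiv 𝓘(ℝ, E) 𝓘(ℝ, E) (extChartAt 𝓘(ℝ, E) x₀).symm y v⟩ : TangentBundle 𝓘(ℝ, E) M)) y :=
    fun v ↦ contMDiffAt_mfderiv_apply (b := id) (V := fun _ ↦ v) (isOpen_extChartAt_target x₀)
      (contMDiffOn_extChartAt_symm x₀) hy (contMDiffAt_vectorSpace_iff_contDiffAt.2 contDiffAt_const)
  exact (contMDiffAt_metric_apply g (hsec v) (hsec w)).contDiffAt.contDiffWithinAt

theorem differentiableAt_coordMetric {y : E} (hy : y ∈ (extChartAt 𝓘(ℝ, E) x₀).target) :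
    DifferentiableAt ℝ (g.coordMetric x₀) y :=
  ((g.contDiffOn_coordMetric x₀).differentiableOn (by simp)).differentiableAt
    ((isOpen_extChartAt_target x₀).mem_nhds hy)

theorem isInvertible_coordMetric {y : E} (hy : y ∈ (extChartAt 𝓘(ℝ, E) x₀).target) :
    (g.coordMetric x₀ y).IsInvertible := by
  have inj : Function.Injective (g.coordMetric x₀ y : E →ₗ[ℝ] E →L[ℝ] ℝ) := by
    rw [injective_iff_map_eq_zero]
    exact fun v hv ↦ g.coordMetric_nondegenerate hy fun w ↦
      congrArg (fun l : E →L[ℝ] ℝ ↦ l w) hv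
  have hdim : Module.finrank ℝ E = Module.finrank ℝ (E →L[ℝ] ℝ) :=
    (Subspace.dual_finrank_eq (K := ℝ) (V := E)).symm.trans
      (LinearMap.toContinuousLinearMap : (E →ₗ[ℝ] ℝ) ≃ₗ[ℝ] (E →L[ℝ] ℝ)).finrank_eq
  exact ⟨(LinearEquiv.ofInjectiveOfFinrankEq (g.coordMetric x₀ y : E →ₗ[ℝ] E →L[ℝ] ℝ) inj
    hdim).toContinuousLinearEquiv, by ext; rfl⟩

theorem coordMetric_christoffel {y : E} (hy : y ∈ (extChartAt 𝓘(ℝ, E) x₀).target) (v w z : E) :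
    g.coordMetric x₀ y (g.christoffel x₀ y v w) z = g.christoffelLower x₀ y v w z :=
  congrArg (fun l : E →L[ℝ] ℝ ↦ l z)
    ((g.isInvertible_coordMetric hy).self_apply_inverse (g.christoffelLower x₀ y v w))

/-- The Koszul formula characterises the Christoffel symbols. -/
theorem christoffel_eq_of_forall {y : E} (hy : y ∈ (extChartAt 𝓘(ℝ, E) x₀).target) {v w Γ : E}
    (h : ∀ z, g.coordMetric x₀ y Γ z = g.christoffelLower x₀ y v w z) :
    g.christoffel x₀ y v w = Γ := by
  rw [← sub_eq_zero]
  refine g.coordMetric_nondegenerate hy fun z ↦ ?_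
  rw [map_sub, sub_apply, g.coordMetric_christoffel hy, h, sub_self]

/-- Supplies the continuity of the coefficients in the parallel transport equation. The inverse
metric is continuous because inversion is continuous at invertible maps. -/
theorem continuousOn_christoffel (x₀ : M) :
    ContinuousOn (g.christoffel x₀) (extChartAt 𝓘(ℝ, E) x₀).target := by
  have hD : ContinuousOn (fderiv ℝ (g.coordMetric x₀)) (extChartAt 𝓘(ℝ, E) x₀).target :=
    (g.contDiffOn_coordMetric x₀).continuousOn_fderiv_of_isOpen (isOpen_extChartAt_target x₀)
      (by simp)
  have hsharp : ContinuousOn (g.coordSharp x₀) (extChartAt 𝓘(ℝ, E) x₀).target := by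
    intro y hy
    obtain ⟨e, he⟩ := g.isInvertible_coordMetric hy
    have h₁ : ContinuousAt (ContinuousLinearMap.inverse : (E →L[ℝ] E →L[ℝ] ℝ) → _)
        (g.coordMetric x₀ y) := he ▸ (contDiffAt_map_inverse (n := 0) e).continuousAt
    exact h₁.comp_continuousWithinAt ((g.contDiffOn_coordMetric x₀).continuousOn y hy)
  have hlower : ContinuousOn (g.christoffelLower x₀) (extChartAt 𝓘(ℝ, E) x₀).target := by
    have hflip : ContinuousOn (fun y ↦ (fderiv ℝ (g.coordMetric x₀) y).flip)
        (extChartAt 𝓘(ℝ, E) x₀).target :=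
      (ContinuousLinearMap.flipₗᵢ ℝ E E (E →L[ℝ] ℝ)).continuous.comp_continuousOn hD
    exact ((hD.add hflip).sub (continuousOn_const.clm_comp hflip)).const_smul (1 / 2 : ℝ)
  exact ((ContinuousLinearMap.compL ℝ E (E →L[ℝ] ℝ) E).continuous.comp_continuousOn
    hsharp).clm_comp hlower

end PseudoRiemannianMetric

end

/-! ### Chain and product rules for vector-valued functions on manifolds -/

section

variable {E : Type*} [NormedAddCommGroup E] [NormedSpace ℝ E]
  {M : Type*} [TopologicalSpace M] [ChartedSpace E M]
  {F : Type*} [NormedAddCommGroup F] [NormedSpace ℝ F]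
  {G : Type*} [NormedAddCommGroup G] [NormedSpace ℝ G]

theorem mvfderiv_eq_fderiv {f : M → F} {x : M} (hf : MDifferentiableAt 𝓘(ℝ, E) 𝓘(ℝ, F) f x) :
    (mvfderiv 𝓘(ℝ, E) f x : E →L[ℝ] F) =
      fderiv ℝ (f ∘ (extChartAt 𝓘(ℝ, E) x).symm) (extChartAt 𝓘(ℝ, E) x x) := by
  rw [hf.mvfderiv, modelWithCornersSelf_coe, range_id,
    fderivWithin_univ]
  rfl

theorem differentiableAt_comp_extChartAt_symm {f : M → F} {x : M}
    (hf : MDifferentiableAt 𝓘(ℝ, E) 𝓘(ℝ, F) f x) :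
    DifferentiableAt ℝ (f ∘ (extChartAt 𝓘(ℝ, E) x).symm) (extChartAt 𝓘(ℝ, E) x x) := by
  have h := hf.differentiableWithinAt_writtenInExtChartAt
  rw [modelWithCornersSelf_coe, range_id, differentiableWithinAt_univ] at h
  exact h

theorem mvfderiv_clm_apply {A : M → F →L[ℝ] G} {f : M → F} {x : M}
    (hA : MDifferentiableAt 𝓘(ℝ, E) 𝓘(ℝ, F →L[ℝ] G) A x)
    (hf : MDifferentiableAt 𝓘(ℝ, E) 𝓘(ℝ, F) f x) (v : TangentSpace 𝓘(ℝ, E) x) :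
    mvfderiv 𝓘(ℝ, E) (fun x ↦ A x (f x)) x v =
      mvfderiv 𝓘(ℝ, E) A x v (f x) + A x (mvfderiv 𝓘(ℝ, E) f x v) := by
  have hAf : MDifferentiableAt 𝓘(ℝ, E) 𝓘(ℝ, G) (fun x ↦ A x (f x)) x := by
    rw [mdifferentiableAt_iff] at hA hf ⊢
    exact ⟨hA.1.clm_apply hf.1, hA.2.clm_apply hf.2⟩
  have h₁ := mvfderiv_eq_fderiv hAf
  have h₂ := mvfderiv_eq_fderiv hA
  have h₃ := mvfderiv_eq_fderiv hf
  have h₄ := ((differentiableAt_comp_extChartAt_symm hA).hasFDerivAt.clm_apply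
    (differentiableAt_comp_extChartAt_symm hf).hasFDerivAt).fderiv
  have h₅ := h₁.trans h₄
  rw [← h₂, ← h₃] at h₅
  refine (congrArg (fun l : E →L[ℝ] G ↦ l v) h₅).trans ?_
  simp only [Function.comp_apply, extChartAt_to_inv]
  exact add_comm _ _

theorem mvfderiv_comp_fderiv {φ : F → G} {f : M → F} {x : M} (hφ : DifferentiableAt ℝ φ (f x))
    (hf : MDifferentiableAt 𝓘(ℝ, E) 𝓘(ℝ, F) f x) (v : TangentSpace 𝓘(ℝ, E) x) :
    mvfderiv 𝓘(ℝ, E) (fun x ↦ φ (f x)) x v = fderiv ℝ φ (f x) (mvfderiv 𝓘(ℝ, E) f x v) := by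
  have h := mfderiv_comp x hφ.mdifferentiableAt hf
  rw [mfderiv_eq_fderiv] at h
  exact congrArg (fun l : E →L[ℝ] G ↦ l v) h

theorem mvfderiv_comp_mfderiv {N : Type*} [TopologicalSpace N] [ChartedSpace F N]
    {φ : M → G} {f : N → M} {s : N} (hφ : MDifferentiableAt 𝓘(ℝ, E) 𝓘(ℝ, G) φ (f s))
    (hf : MDifferentiableAt 𝓘(ℝ, F) 𝓘(ℝ, E) f s) (v : TangentSpace 𝓘(ℝ, F) s) :
    mvfderiv 𝓘(ℝ, F) (fun s ↦ φ (f s)) s v =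
      mvfderiv 𝓘(ℝ, E) φ (f s) (mfderiv 𝓘(ℝ, F) 𝓘(ℝ, E) f s v) :=
  congrArg (fun l : F →L[ℝ] G ↦ l v) (mfderiv_comp s hφ hf)

theorem mvfderiv_congr {f f' : M → F} {x : M} (h : f =ᶠ[nhds x] f') :
    mvfderiv 𝓘(ℝ, E) f x = mvfderiv 𝓘(ℝ, E) f' x := by
  ext v
  exact congrArg (fun l : E →L[ℝ] F ↦ l v) h.mfderiv_eq

end

/-! ### Christoffel symbols under change of chart and conformal rescaling -/

section

variable {E : Type*} [NormedAddCommGroup E] [NormedSpace ℝ E]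
  {M : Type*} [TopologicalSpace M] [ChartedSpace E M] [IsManifold 𝓘(ℝ, E) ∞ M]

/-- The transition map from the preferred chart at `x₀` to the preferred chart at `x₁`. -/
def transition (E : Type*) [NormedAddCommGroup E] [NormedSpace ℝ E]
    {M : Type*} [TopologicalSpace M] [ChartedSpace E M] (x₀ x₁ : M) (y : E) : E :=
  extChartAt 𝓘(ℝ, E) x₁ ((extChartAt 𝓘(ℝ, E) x₀).symm y)

variable {x₀ x₁ x : M}

theorem contMDiffAt_extChartAt_of_mem (h : x ∈ (extChartAt 𝓘(ℝ, E) x₀).source) :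
    ContMDiffAt 𝓘(ℝ, E) 𝓘(ℝ, E) ∞ (extChartAt 𝓘(ℝ, E) x₀) x :=
  contMDiffAt_extChartAt' (by rwa [extChartAt_source] at h)

theorem mdifferentiableAt_extChartAt_of_mem (h : x ∈ (extChartAt 𝓘(ℝ, E) x₀).source) :
    MDifferentiableAt 𝓘(ℝ, E) 𝓘(ℝ, E) (extChartAt 𝓘(ℝ, E) x₀) x :=
  (contMDiffAt_extChartAt_of_mem h).mdifferentiableAt (by simp)

theorem contDiffAt_transition (h₀ : x ∈ (extChartAt 𝓘(ℝ, E) x₀).source)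
    (h₁ : x ∈ (extChartAt 𝓘(ℝ, E) x₁).source) :
    ContDiffAt ℝ ∞ (transition E x₀ x₁) (extChartAt 𝓘(ℝ, E) x₀ x) := by
  have hsymm : ContMDiffAt 𝓘(ℝ, E) 𝓘(ℝ, E) ∞ (extChartAt 𝓘(ℝ, E) x₀).symm
      (extChartAt 𝓘(ℝ, E) x₀ x) :=
    (contMDiffOn_extChartAt_symm x₀).contMDiffAt
      ((isOpen_extChartAt_target x₀).mem_nhds ((extChartAt 𝓘(ℝ, E) x₀).map_source h₀))
  exact ((contMDiffAt_extChartAt_of_mem h₁).comp_of_eq hsymm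
    ((extChartAt 𝓘(ℝ, E) x₀).left_inv h₀)).contDiffAt

theorem fderiv_transition_tangentCoord (h₀ : x ∈ (extChartAt 𝓘(ℝ, E) x₀).source)
    (h₁ : x ∈ (extChartAt 𝓘(ℝ, E) x₁).source) (v : TangentSpace 𝓘(ℝ, E) x) :
    fderiv ℝ (transition E x₀ x₁) (extChartAt 𝓘(ℝ, E) x₀ x) (tangentCoord E x₀ x v) =
      tangentCoord E x₁ x v := by
  have hev : (fun x ↦ transition E x₀ x₁ (extChartAt 𝓘(ℝ, E) x₀ x)) =ᶠ[nhds x]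
      extChartAt 𝓘(ℝ, E) x₁ := by
    filter_upwards [(isOpen_extChartAt_source (I := 𝓘(ℝ, E)) x₀).mem_nhds h₀] with x' hx'
    rw [transition, (extChartAt 𝓘(ℝ, E) x₀).left_inv hx']
  rw [tangentCoord, tangentCoord, ← mvfderiv_congr hev]
  exact (mvfderiv_comp_fderiv ((contDiffAt_transition h₀ h₁).differentiableAt (by simp))
    (mdifferentiableAt_extChartAt_of_mem h₀) v).symm

theorem exists_tangentCoord_eq (h₀ : x ∈ (extChartAt 𝓘(ℝ, E) x₀).source) (v : E) :
    ∃ V : TangentSpace 𝓘(ℝ, E) x, tangentCoord E x₀ x V = v := by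
  have h := tangentCoord_mfderiv_symm ((extChartAt 𝓘(ℝ, E) x₀).map_source h₀) v
  rw [(extChartAt 𝓘(ℝ, E) x₀).left_inv h₀] at h
  exact ⟨_, h⟩

namespace PseudoRiemannianMetric

variable (g : PseudoRiemannianMetric E M)

theorem coordMetric_transition (h₀ : x ∈ (extChartAt 𝓘(ℝ, E) x₀).source)
    (h₁ : x ∈ (extChartAt 𝓘(ℝ, E) x₁).source) (v w : E) :
    g.coordMetric x₁ (extChartAt 𝓘(ℝ, E) x₁ x)
      (fderiv ℝ (transition E x₀ x₁) (extChartAt 𝓘(ℝ, E) x₀ x) v)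
      (fderiv ℝ (transition E x₀ x₁) (extChartAt 𝓘(ℝ, E) x₀ x) w) =
      g.coordMetric x₀ (extChartAt 𝓘(ℝ, E) x₀ x) v w := by
  obtain ⟨V, rfl⟩ := exists_tangentCoord_eq h₀ v
  obtain ⟨W, rfl⟩ := exists_tangentCoord_eq h₀ w
  rw [fderiv_transition_tangentCoord h₀ h₁, fderiv_transition_tangentCoord h₀ h₁,
    g.coordMetric_tangentCoord h₀, g.coordMetric_tangentCoord h₁]

variable [FiniteDimensional ℝ E]

/-- Obtained by differentiating the tensor law `coordMetric_transition`, which holds on a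
neighbourhood; the two terms in `T'` come from differentiating the Jacobian in each slot. -/
theorem fderiv_coordMetric_transition (h₀ : x ∈ (extChartAt 𝓘(ℝ, E) x₀).source)
    (h₁ : x ∈ (extChartAt 𝓘(ℝ, E) x₁).source) (z v w : E) :
    let y₀ := extChartAt 𝓘(ℝ, E) x₀ x
    let y₁ := extChartAt 𝓘(ℝ, E) x₁ x
    let T := fderiv ℝ (transition E x₀ x₁) y₀
    let T' := fderiv ℝ (fderiv ℝ (transition E x₀ x₁)) y₀
    fderiv ℝ (g.coordMetric x₀) y₀ z v w =
      fderiv ℝ (g.coordMetric x₁) y₁ (T z) (T v) (T w) +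
        g.coordMetric x₁ y₁ (T' z v) (T w) + g.coordMetric x₁ y₁ (T v) (T' z w) := by
  intro y₀ y₁ T T'
  have hτy : transition E x₀ x₁ y₀ = y₁ := by
    simp only [y₀, y₁, transition, (extChartAt 𝓘(ℝ, E) x₀).left_inv h₀]
  have hτ : HasFDerivAt (transition E x₀ x₁) T y₀ :=
    ((contDiffAt_transition h₀ h₁).differentiableAt (by simp)).hasFDerivAt
  have hT : HasFDerivAt (fderiv ℝ (transition E x₀ x₁)) T' y₀ :=
    (((contDiffAt_transition h₀ h₁).fderiv_right (m := ∞) (by simp)).differentiableAt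
      (by simp)).hasFDerivAt
  have hB₁ : HasFDerivAt (g.coordMetric x₁) (fderiv ℝ (g.coordMetric x₁) y₁)
      (transition E x₀ x₁ y₀) := by
    rw [hτy]
    exact (g.differentiableAt_coordMetric ((extChartAt 𝓘(ℝ, E) x₁).map_source h₁)).hasFDerivAt
  have hB₀ : HasFDerivAt (g.coordMetric x₀) (fderiv ℝ (g.coordMetric x₀) y₀) y₀ :=
    (g.differentiableAt_coordMetric ((extChartAt 𝓘(ℝ, E) x₀).map_source h₀)).hasFDerivAt
  have hleft := (hB₀.clm_apply (hasFDerivAt_const v y₀)).clm_apply (hasFDerivAt_const w y₀)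
  have hright := ((hB₁.comp y₀ hτ).clm_apply (hT.clm_apply (hasFDerivAt_const v y₀))).clm_apply
    (hT.clm_apply (hasFDerivAt_const w y₀))
  have hev : (fun y ↦ g.coordMetric x₀ y v w) =ᶠ[nhds y₀] fun y ↦
      (g.coordMetric x₁ ∘ transition E x₀ x₁) y (fderiv ℝ (transition E x₀ x₁) y v)
        (fderiv ℝ (transition E x₀ x₁) y w) := by
    have hpre := (continuousAt_extChartAt_symm' h₀).preimage_mem_nhds
      ((isOpen_extChartAt_source (I := 𝓘(ℝ, E)) x₁).mem_nhds
        (by rwa [(extChartAt 𝓘(ℝ, E) x₀).left_inv h₀]))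
    filter_upwards [hpre, (isOpen_extChartAt_target (I := 𝓘(ℝ, E)) x₀).mem_nhds
      ((extChartAt 𝓘(ℝ, E) x₀).map_source h₀)] with y hy₁ hy₀
    have h := g.coordMetric_transition ((extChartAt 𝓘(ℝ, E) x₀).map_target hy₀) hy₁ v w
    rw [(extChartAt 𝓘(ℝ, E) x₀).right_inv hy₀] at h
    exact h.symm
  have h := congrArg (fun l : E →L[ℝ] ℝ ↦ l z) (hleft.unique (hright.congr_of_eventuallyEq hev))
  simp only [add_apply, ContinuousLinearMap.comp_apply, ContinuousLinearMap.flip_apply,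
    Function.comp_apply, zero_apply, map_zero, zero_add, hτy] at h
  rw [h]
  simp only [T]
  ring

/-- The transformation law of the Christoffel symbols under a change of charts. -/
theorem christoffel_transition (h₀ : x ∈ (extChartAt 𝓘(ℝ, E) x₀).source)
    (h₁ : x ∈ (extChartAt 𝓘(ℝ, E) x₁).source) (v w : E) :
    let y₀ := extChartAt 𝓘(ℝ, E) x₀ x
    let T := fderiv ℝ (transition E x₀ x₁) y₀
    g.christoffel x₁ (extChartAt 𝓘(ℝ, E) x₁ x) (T v) (T w) =
      T (g.christoffel x₀ y₀ v w) - fderiv ℝ (fderiv ℝ (transition E x₀ x₁)) y₀ v w := by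
  dsimp only
  have hsymm : IsSymmSndFDerivAt ℝ (transition E x₀ x₁) (extChartAt 𝓘(ℝ, E) x₀ x) :=
    (contDiffAt_transition h₀ h₁).isSymmSndFDerivAt (by simpa using! ENat.LEInfty.out)
  refine g.christoffel_eq_of_forall ((extChartAt 𝓘(ℝ, E) x₁).map_source h₁) fun z' ↦ ?_
  obtain ⟨Z, rfl⟩ := exists_tangentCoord_eq h₁ z'
  rw [← fderiv_transition_tangentCoord h₀ h₁]
  set z := tangentCoord E x₀ x Z
  have e₁ := g.fderiv_coordMetric_transition h₀ h₁ v w z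
  have e₂ := g.fderiv_coordMetric_transition h₀ h₁ w v z
  have e₃ := g.fderiv_coordMetric_transition h₀ h₁ z v w
  simp only [hsymm.eq w v, hsymm.eq z v, hsymm.eq z w] at e₁ e₂ e₃
  have s₁ := g.coordMetric_symm x₁ (extChartAt 𝓘(ℝ, E) x₁ x)
    (fderiv ℝ (fderiv ℝ (transition E x₀ x₁)) (extChartAt 𝓘(ℝ, E) x₀ x) v z)
    (fderiv ℝ (transition E x₀ x₁) (extChartAt 𝓘(ℝ, E) x₀ x) w)
  rw [map_sub, sub_apply, g.coordMetric_transition h₀ h₁,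
    g.coordMetric_christoffel ((extChartAt 𝓘(ℝ, E) x₀).map_source h₀), christoffelLower_apply,
    christoffelLower_apply]
  -- In the Koszul combination the second-derivative terms paired with `T v` and `T w` cancel, by
  -- symmetry of second derivatives and of the metric; twice the term paired with `T z` remains.
  linear_combination (1 / 2 : ℝ) * (e₁ + e₂ - e₃ - s₁)

/-- The general formula has a further term `-g(v, w) grad φ`. It vanishes for orthogonal arguments,
which is the reason why null geodesics are conformally invariant. -/
theorem christoffel_of_isRescaling {ĝ : PseudoRiemannianMetric E M} {φ : M → ℝ}
    (h : IsRescaling φ g ĝ) {y : E} (hy : y ∈ (extChartAt 𝓘(ℝ, E) x₀).target) {v w : E}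
    (hvw : g.coordMetric x₀ y v w = 0) :
    let dφ := fderiv ℝ (φ ∘ (extChartAt 𝓘(ℝ, E) x₀).symm) y
    ĝ.christoffel x₀ y v w = g.christoffel x₀ y v w + dφ v • w + dφ w • v := by
  intro dφ
  have hφ : HasFDerivAt (φ ∘ (extChartAt 𝓘(ℝ, E) x₀).symm) dφ y := by
    have hsymm := (contMDiffOn_extChartAt_symm (I := 𝓘(ℝ, E)) (n := ∞) x₀).contMDiffAt
      ((isOpen_extChartAt_target x₀).mem_nhds hy)
    exact ((h.1.contMDiffAt.comp y hsymm).contDiffAt.differentiableAt (by simp)).hasFDerivAt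
  have hĝ : ĝ.coordMetric x₀ = fun y ↦
      Real.exp (2 * (φ ∘ (extChartAt 𝓘(ℝ, E) x₀).symm) y) • g.coordMetric x₀ y := by
    funext y
    ext v w
    exact h.2 _ _ _
  have hexp := (hφ.const_mul 2).exp.fun_smul (g.differentiableAt_coordMetric hy).hasFDerivAt
  have hd : ∀ z v w : E, fderiv ℝ (ĝ.coordMetric x₀) y z v w =
      Real.exp (2 * (φ ∘ (extChartAt 𝓘(ℝ, E) x₀).symm) y) *
        (fderiv ℝ (g.coordMetric x₀) y z v w + 2 * dφ z * g.coordMetric x₀ y v w) := by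
    intro z v w
    rw [hĝ, hexp.fderiv]
    simp
    ring
  refine ĝ.christoffel_eq_of_forall hy fun z ↦ ?_
  rw [christoffelLower_apply, hd, hd, hd, hĝ]
  simp only [smul_apply, map_add, add_apply, map_smul, smul_eq_mul, g.coordMetric_christoffel hy,
    christoffelLower_apply, hvw]
  ring

end PseudoRiemannianMetric

end

/-! ### Tangent vector fields along the curve -/

section

variable {E : Type*} [NormedAddCommGroup E] [NormedSpace ℝ E]
  {M : Type*} [TopologicalSpace M] [ChartedSpace E M]
  {N : Type*} [TopologicalSpace N] [ChartedSpace ℝ N]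
  {γ : N → M} {x₁ : M} {s₀ : N}

theorem eventually_mem_source (hγ : ContMDiff 𝓘(ℝ, ℝ) 𝓘(ℝ, E) ∞ γ)
    (h₁ : γ s₀ ∈ (extChartAt 𝓘(ℝ, E) x₁).source) :
    ∀ᶠ s in nhds s₀, γ s ∈ (extChartAt 𝓘(ℝ, E) x₁).source :=
  hγ.continuous.continuousAt.preimage_mem_nhds
    ((isOpen_extChartAt_source (I := 𝓘(ℝ, E)) x₁).mem_nhds h₁)

theorem mdifferentiableAt_curve (hγ : ContMDiff 𝓘(ℝ, ℝ) 𝓘(ℝ, E) ∞ γ) :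
    MDifferentiableAt 𝓘(ℝ, ℝ) 𝓘(ℝ, E) γ s₀ :=
  hγ.contMDiffAt.mdifferentiableAt (by simp)

variable [IsManifold 𝓘(ℝ, E) ∞ M]

theorem mvfderiv_extChartAt_comp (hγ : ContMDiff 𝓘(ℝ, ℝ) 𝓘(ℝ, E) ∞ γ)
    (h₁ : γ s₀ ∈ (extChartAt 𝓘(ℝ, E) x₁).source) (v : TangentSpace 𝓘(ℝ, ℝ) s₀) :
    mvfderiv 𝓘(ℝ, ℝ) (fun s ↦ extChartAt 𝓘(ℝ, E) x₁ (γ s)) s₀ v =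
      tangentCoord E x₁ (γ s₀) (pushforward γ s₀ v) :=
  mvfderiv_comp_mfderiv (mdifferentiableAt_extChartAt_of_mem h₁) (mdifferentiableAt_curve hγ) v

/-- The covariant derivative along a curve can be computed in any chart. -/
theorem covDerivAlong_transition [FiniteDimensional ℝ E] (g : PseudoRiemannianMetric E M)
    (hγ : ContMDiff 𝓘(ℝ, ℝ) 𝓘(ℝ, E) ∞ γ) {U : ∀ s : N, TangentSpace 𝓘(ℝ, E) (γ s)}
    (hU : MDifferentiableAt 𝓘(ℝ, ℝ) 𝓘(ℝ, E) (fun s ↦ tangentCoord E (γ s₀) (γ s) (U s)) s₀)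
    (h₁ : γ s₀ ∈ (extChartAt 𝓘(ℝ, E) x₁).source) (v : TangentSpace 𝓘(ℝ, ℝ) s₀) :
    mvfderiv 𝓘(ℝ, ℝ) (fun s ↦ tangentCoord E x₁ (γ s) (U s)) s₀ v +
        g.christoffel x₁ (extChartAt 𝓘(ℝ, E) x₁ (γ s₀))
          (tangentCoord E x₁ (γ s₀) (pushforward γ s₀ v)) (tangentCoord E x₁ (γ s₀) (U s₀)) =
      fderiv ℝ (transition E (γ s₀) x₁) (extChartAt 𝓘(ℝ, E) (γ s₀) (γ s₀))
        (covDerivAlong g γ U s₀ v) := by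
  have h₀ : γ s₀ ∈ (extChartAt 𝓘(ℝ, E) (γ s₀)).source := mem_extChartAt_source (γ s₀)
  have hev : (fun s ↦ tangentCoord E x₁ (γ s) (U s)) =ᶠ[nhds s₀] fun s ↦
      fderiv ℝ (transition E (γ s₀) x₁) (extChartAt 𝓘(ℝ, E) (γ s₀) (γ s))
        (tangentCoord E (γ s₀) (γ s) (U s)) := by
    filter_upwards [eventually_mem_source hγ h₀, eventually_mem_source hγ h₁] with s hs₀ hs₁
    rw [fderiv_transition_tangentCoord hs₀ hs₁]
  have hy : MDifferentiableAt 𝓘(ℝ, ℝ) 𝓘(ℝ, E) (fun s ↦ extChartAt 𝓘(ℝ, E) (γ s₀) (γ s)) s₀ :=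
    (mdifferentiableAt_extChartAt_of_mem h₀).comp s₀ (mdifferentiableAt_curve hγ)
  have hT : DifferentiableAt ℝ (fderiv ℝ (transition E (γ s₀) x₁))
      (extChartAt 𝓘(ℝ, E) (γ s₀) (γ s₀)) :=
    ((contDiffAt_transition h₀ h₁).fderiv_right (m := ∞) (by simp)).differentiableAt (by simp)
  have hA : MDifferentiableAt 𝓘(ℝ, ℝ) 𝓘(ℝ, E →L[ℝ] E) (fun s ↦
      fderiv ℝ (transition E (γ s₀) x₁) (extChartAt 𝓘(ℝ, E) (γ s₀) (γ s))) s₀ :=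
    MDifferentiableAt.comp s₀ (g := fderiv ℝ (transition E (γ s₀) x₁)) hT.mdifferentiableAt hy
  have hd := mvfderiv_comp_fderiv (f := fun s ↦ extChartAt 𝓘(ℝ, E) (γ s₀) (γ s)) hT hy v
  rw [mvfderiv_congr hev, mvfderiv_clm_apply hA hU, hd, mvfderiv_extChartAt_comp hγ h₀, ← fderiv_transition_tangentCoord h₀ h₁,
    ← fderiv_transition_tangentCoord h₀ h₁, g.christoffel_transition h₀ h₁, covDerivAlong, map_add]
  abel

theorem covDerivAlong_smul (g : PseudoRiemannianMetric E M)
    (U : ∀ s : N, TangentSpace 𝓘(ℝ, E) (γ s)) (r : ℝ) (v : TangentSpace 𝓘(ℝ, ℝ) s₀) :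
    covDerivAlong g γ U s₀ (r • v) = r • covDerivAlong g γ U s₀ v := by
  simp only [covDerivAlong, map_smul, smul_add, smul_apply]

/-- The tangent spaces of `N` are copies of `ℝ`, so the factor is a quotient of real numbers. -/
theorem eq_smul_of_ne_zero {s : N} {v w : TangentSpace 𝓘(ℝ, ℝ) s} (hw : w ≠ 0) :
    ∃ r : ℝ, v = r • w :=
  ⟨(show ℝ from v) / (show ℝ from w), (div_mul_cancel₀ (show ℝ from v) hw).symm⟩

variable [IsManifold 𝓘(ℝ, ℝ) ∞ N]

/-- Smoothness of a vector field on a 1-manifold. -/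
def IsSmoothField (V : ∀ s : N, TangentSpace 𝓘(ℝ, ℝ) s) : Prop :=
  ContMDiff 𝓘(ℝ, ℝ) 𝓘(ℝ, ℝ).tangent ∞ (fun s ↦ (⟨s, V s⟩ : TangentBundle 𝓘(ℝ, ℝ) N))

variable {V W : ∀ s : N, TangentSpace 𝓘(ℝ, ℝ) s}

theorem IsSmoothField.smul (hV : IsSmoothField V) {f : N → ℝ}
    (hf : ContMDiff 𝓘(ℝ, ℝ) 𝓘(ℝ, ℝ) ∞ f) : IsSmoothField (fun s ↦ f s • V s) :=
  hf.smul_section hV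

theorem contMDiffAt_tangentCoord_pushforward (hγ : ContMDiff 𝓘(ℝ, ℝ) 𝓘(ℝ, E) ∞ γ)
    (hV : IsSmoothField V) (h₁ : γ s₀ ∈ (extChartAt 𝓘(ℝ, E) x₁).source) :
    ContMDiffAt 𝓘(ℝ, ℝ) 𝓘(ℝ, E) ∞
      (fun s ↦ tangentCoord E x₁ (γ s) (pushforward γ s (V s))) s₀ :=
  contMDiffAt_mvfderiv_apply (isOpen_extChartAt_source x₁)
    (fun _ hx ↦ (contMDiffAt_extChartAt_of_mem hx).contMDiffWithinAt) (b := γ) h₁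
    (contMDiffAt_mfderiv_apply isOpen_univ hγ.contMDiffOn (b := id) (mem_univ _) (hV s₀))

/-- `V` is a vector field on `N` whose push-forward is null and parallel along `γ`. -/
structure IsNullParallelField (g : PseudoRiemannianMetric E M) (γ : N → M)
    (V : ∀ s : N, TangentSpace 𝓘(ℝ, ℝ) s) : Prop where
  smooth : IsSmoothField V
  null : ∀ s (v : TangentSpace 𝓘(ℝ, ℝ) s), g.val (γ s) (pushforward γ s v) (pushforward γ s (V s)) = 0
  parallel : ∀ s (v : TangentSpace 𝓘(ℝ, ℝ) s),
    covDerivAlong g γ (fun t ↦ pushforward γ t (V t)) s v = 0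

/-- Near `s₀` the coefficient is the quotient `l(f W) / l(W)`, for a functional `l` that does not
vanish on the image of `W s₀`. -/
theorem contMDiff_of_smul_field (hγ : ContMDiff 𝓘(ℝ, ℝ) 𝓘(ℝ, E) ∞ γ)
    (hinj : ∀ s, Function.Injective (pushforward (E := E) γ s)) {f : N → ℝ}
    (hW : IsSmoothField W) (hW₀ : ∀ s, W s ≠ 0) (hfW : ∀ s₀ (l : E →L[ℝ] ℝ),
      ContMDiffAt 𝓘(ℝ, ℝ) 𝓘(ℝ, ℝ) ∞
        (fun s ↦ l (tangentCoord E (γ s₀) (γ s) (pushforward γ s (f s • W s)))) s₀) :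
    ContMDiff 𝓘(ℝ, ℝ) 𝓘(ℝ, ℝ) ∞ f := by
  intro s₀
  have h₀ : γ s₀ ∈ (extChartAt 𝓘(ℝ, E) (γ s₀)).source := mem_extChartAt_source (γ s₀)
  have hne : tangentCoord E (γ s₀) (γ s₀) (pushforward γ s₀ (W s₀)) ≠ 0 := fun h ↦
    hW₀ s₀ (hinj s₀ (tangentCoord_injective h₀ (by rw [h, map_zero, map_zero])))
  obtain ⟨l, hl⟩ := SeparatingDual.exists_ne_zero (R := ℝ) hne
  have hden : ContMDiffAt 𝓘(ℝ, ℝ) 𝓘(ℝ, ℝ) ∞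
      (fun s ↦ l (tangentCoord E (γ s₀) (γ s) (pushforward γ s (W s)))) s₀ :=
    l.contDiff.contMDiff.contMDiffAt.comp s₀ (contMDiffAt_tangentCoord_pushforward hγ hW h₀)
  refine ((hfW s₀ l).div₀ hden hl).congr_of_eventuallyEq ?_
  filter_upwards [hden.continuousAt.eventually_ne hl] with s hs
  simp only [map_smul, smul_eq_mul, Pi.div_apply]
  field_simp

/-- On a ball in a chart, which is convex, a function with zero derivative is constant;
connectedness of `N` globalises this. -/
theorem exists_const_of_mvfderiv_eq_zero [ConnectedSpace N] {f : N → ℝ}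
    (hf : MDifferentiable 𝓘(ℝ, ℝ) 𝓘(ℝ, ℝ) f) (h : ∀ s, mvfderiv 𝓘(ℝ, ℝ) f s = 0) :
    ∃ r, ∀ s, f s = r := by
  have hloc : IsLocallyConstant f := by
    rw [IsLocallyConstant.iff_eventually_eq]
    intro s₀
    set ψ := extChartAt 𝓘(ℝ, ℝ) s₀
    obtain ⟨ε, hε, hball⟩ := Metric.isOpen_iff.1 (isOpen_extChartAt_target (I := 𝓘(ℝ, ℝ)) s₀)
      (ψ s₀) (mem_extChartAt_target s₀)
    have hd : ∀ t ∈ Metric.ball (ψ s₀) ε, HasFDerivAt (f ∘ ψ.symm) (0 : ℝ →L[ℝ] ℝ) t := by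
      intro t ht
      have hsymm : MDifferentiableAt 𝓘(ℝ, ℝ) 𝓘(ℝ, ℝ) ψ.symm t :=
        ((contMDiffOn_extChartAt_symm (n := ∞) s₀).contMDiffAt
          ((isOpen_extChartAt_target s₀).mem_nhds (hball ht))).mdifferentiableAt (by simp)
      have h₁ : mfderiv 𝓘(ℝ, ℝ) 𝓘(ℝ, ℝ) f (ψ.symm t) = 0 := h (ψ.symm t)
      have h₂ := (hf (ψ.symm t)).hasMFDerivAt.comp t hsymm.hasMFDerivAt
      rw [h₁] at h₂
      have h₃ := h₂.hasFDerivAt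
      rwa [ContinuousLinearMap.zero_comp] at h₃
    have hmem : ψ ⁻¹' Metric.ball (ψ s₀) ε ∈ nhds s₀ :=
      (continuousAt_extChartAt s₀).preimage_mem_nhds (Metric.ball_mem_nhds _ hε)
    filter_upwards [hmem, extChartAt_source_mem_nhds (I := 𝓘(ℝ, ℝ)) s₀] with s hs hs'
    have := (convex_ball (ψ s₀) ε).is_const_of_fderivWithin_eq_zero (𝕜 := ℝ)
      (fun t ht ↦ (hd t ht).differentiableAt.differentiableWithinAt)
      (fun t ht ↦ (hd t ht).hasFDerivWithinAt.fderivWithin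
        (Metric.isOpen_ball.uniqueDiffWithinAt ht)) hs (Metric.mem_ball_self hε)
    rwa [Function.comp_apply, Function.comp_apply, (extChartAt 𝓘(ℝ, ℝ) s₀).left_inv hs',
      extChartAt_to_inv] at this
  obtain ⟨s₁⟩ : Nonempty N := inferInstance
  exact ⟨f s₁, fun s ↦ hloc.apply_eq_of_isPreconnected isPreconnected_univ trivial trivial⟩

variable {g : PseudoRiemannianMetric E M}

theorem IsNullParallelField.mdifferentiableAt (hγ : ContMDiff 𝓘(ℝ, ℝ) 𝓘(ℝ, E) ∞ γ)
    (hV : IsNullParallelField g γ V) (h₁ : γ s₀ ∈ (extChartAt 𝓘(ℝ, E) x₁).source) :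
    MDifferentiableAt 𝓘(ℝ, ℝ) 𝓘(ℝ, E)
      (fun s ↦ tangentCoord E x₁ (γ s) (pushforward γ s (V s))) s₀ :=
  (contMDiffAt_tangentCoord_pushforward hγ hV.smooth h₁).mdifferentiableAt (by simp)

theorem covDerivAlong_pushforward_smul (hγ : ContMDiff 𝓘(ℝ, ℝ) 𝓘(ℝ, E) ∞ γ)
    (hW : IsSmoothField W) {f : N → ℝ} (hf : MDifferentiableAt 𝓘(ℝ, ℝ) 𝓘(ℝ, ℝ) f s₀)
    (v : TangentSpace 𝓘(ℝ, ℝ) s₀) :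
    covDerivAlong g γ (fun s ↦ pushforward γ s (f s • W s)) s₀ v =
      f s₀ • covDerivAlong g γ (fun s ↦ pushforward γ s (W s)) s₀ v +
        mvfderiv 𝓘(ℝ, ℝ) f s₀ v •
          tangentCoord E (γ s₀) (γ s₀) (pushforward γ s₀ (W s₀)) := by
  have hd : MDifferentiableAt 𝓘(ℝ, ℝ) 𝓘(ℝ, E)
      (fun s ↦ tangentCoord E (γ s₀) (γ s) (pushforward γ s (W s))) s₀ :=
    (contMDiffAt_tangentCoord_pushforward hγ hW
      (mem_extChartAt_source (γ s₀))).mdifferentiableAt (by simp)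
  simp only [covDerivAlong, map_smul]
  rw [mvfderiv_fun_smul hf hd]
  simp only [add_apply, smul_apply, ContinuousLinearMap.smulRight_apply, smul_add]
  abel

/-- Two null parallel fields, one of them nowhere vanishing, are proportional. -/
theorem IsNullParallelField.exists_eq_smul [ConnectedSpace N]
    (hγ : ContMDiff 𝓘(ℝ, ℝ) 𝓘(ℝ, E) ∞ γ)
    (hinj : ∀ s, Function.Injective (pushforward (E := E) γ s))
    (hV : IsNullParallelField g γ V) (hW : IsNullParallelField g γ W) (hW₀ : ∀ s, W s ≠ 0) :
    ∃ r : ℝ, ∀ s, V s = r • W s := by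
  choose f hf using fun s ↦ eq_smul_of_ne_zero (v := V s) (hW₀ s)
  obtain rfl : V = fun s ↦ f s • W s := funext hf
  have hsmooth : ContMDiff 𝓘(ℝ, ℝ) 𝓘(ℝ, ℝ) ∞ f :=
    contMDiff_of_smul_field hγ hinj hW.smooth hW₀ fun s₀ l ↦
      l.contDiff.contMDiff.contMDiffAt.comp s₀
        (contMDiffAt_tangentCoord_pushforward hγ hV.smooth (mem_extChartAt_source (γ s₀)))
  have hfd : MDifferentiable 𝓘(ℝ, ℝ) 𝓘(ℝ, ℝ) f := hsmooth.mdifferentiable (by simp)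
  obtain ⟨r, hr⟩ := exists_const_of_mvfderiv_eq_zero hfd fun s₀ ↦ ContinuousLinearMap.ext fun v ↦ by
    have h₀ : γ s₀ ∈ (extChartAt 𝓘(ℝ, E) (γ s₀)).source := mem_extChartAt_source (γ s₀)
    -- With `V = f W` and both fields parallel, the Leibniz rule leaves `df(v) W = 0`, and `W` has
    -- nonzero image.
    have h₃ := hV.parallel s₀ v
    rw [covDerivAlong_pushforward_smul hγ hW.smooth (hfd s₀), hW.parallel, smul_zero,
      zero_add] at h₃
    have hne : tangentCoord E (γ s₀) (γ s₀) (pushforward γ s₀ (W s₀)) ≠ 0 := fun h ↦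
      hW₀ s₀ (hinj s₀ (tangentCoord_injective h₀ (by rw [h, map_zero, map_zero])))
    exact (smul_eq_zero.1 h₃).resolve_right hne
  exact ⟨r, fun s ↦ by simp only [hr]⟩

end

/-! ### Immersions have injective differential -/

section

variable {E : Type*} [NormedAddCommGroup E] [NormedSpace ℝ E]
  {M : Type*} [TopologicalSpace M] [ChartedSpace E M]
  {F : Type*} [NormedAddCommGroup F] [NormedSpace ℝ F]
  {N : Type*} [TopologicalSpace N] [ChartedSpace F N]

/-- In the charts adapted to an immersion, `f` becomes the injective linear map `j`; the chart
differentials are injective as well. -/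
theorem mfderiv_injective_of_isImmersionAt {f : N → M} {s : N}
    (h : Manifold.IsImmersionAt 𝓘(ℝ, F) 𝓘(ℝ, E) ∞ f s) :
    Function.Injective (mfderiv 𝓘(ℝ, F) 𝓘(ℝ, E) f s) := by
  rw [injective_iff_map_eq_zero]
  intro v hv
  have hdom : h.domChart.MDifferentiable 𝓘(ℝ, F) 𝓘(ℝ, F) :=
    ⟨(contMDiffOn_of_mem_maximalAtlas h.domChart_mem_maximalAtlas).mdifferentiableOn (by simp),
      (contMDiffOn_symm_of_mem_maximalAtlas h.domChart_mem_maximalAtlas).mdifferentiableOn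
        (by simp)⟩
  have hcod : MDifferentiableAt 𝓘(ℝ, E) 𝓘(ℝ, E) h.codChart (f s) :=
    (contMDiffAt_of_mem_maximalAtlas h.codChart_mem_maximalAtlas
      h.mem_codChart_source).mdifferentiableAt (by simp)
  have hf : MDifferentiableAt 𝓘(ℝ, F) 𝓘(ℝ, E) f s := h.contMDiffAt.mdifferentiableAt (by simp)
  let j : F →L[ℝ] E := h.equiv.toContinuousLinearMap ∘L ContinuousLinearMap.inl ℝ F h.complement
  have hj : Function.Injective j :=
    h.equiv.injective.comp fun a b hab ↦ (Prod.ext_iff.1 hab).1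
  have hev : (fun s ↦ h.codChart (f s)) =ᶠ[nhds s] fun s ↦ j (h.domChart s) := by
    filter_upwards [h.domChart.open_source.mem_nhds h.mem_domChart_source] with s' hs'
    have hmem : s' ∈ (h.domChart.extend 𝓘(ℝ, F)).source := by
      rwa [OpenPartialHomeomorph.extend_source]
    have h' := h.writtenInCharts ((h.domChart.extend 𝓘(ℝ, F)).map_source hmem)
    rw [Function.comp_apply, Function.comp_apply, (h.domChart.extend 𝓘(ℝ, F)).left_inv hmem] at h'
    exact h'
  have h₁ := mvfderiv_comp_mfderiv (φ := h.codChart) hcod hf v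
  have h₂ := mvfderiv_comp_fderiv (φ := j) (f := h.domChart) (x := s) j.differentiableAt
    (hdom.mdifferentiableAt h.mem_domChart_source) v
  rw [mvfderiv_congr hev, h₂, hv, map_zero, j.fderiv] at h₁
  have h₃ : mvfderiv 𝓘(ℝ, F) h.domChart s v = 0 := hj (by rw [h₁, map_zero])
  exact hdom.mfderiv_injective h.mem_domChart_source (h₃.trans (map_zero _).symm)

end

/-! ### Uniqueness for linear differential equations -/

section

variable {E : Type*} [NormedAddCommGroup E] [NormedSpace ℝ E]

/-- Uniqueness of the zero solution of a linear ordinary differential equation. -/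
theorem eventually_eq_zero_of_linear_ode {B : ℝ → E →L[ℝ] E} {m : ℝ → E} {t₀ : ℝ} {U : Set ℝ}
    (hU : IsOpen U) (ht₀ : t₀ ∈ U) (hB : ContinuousOn B U)
    (hm : ∀ t ∈ U, HasDerivAt m (B t (m t)) t) (h₀ : m t₀ = 0) :
    ∀ᶠ t in nhds t₀, m t = 0 := by
  -- On a small interval `‖B t₀‖ + 1` serves as a Lipschitz constant uniform in time.
  have hbound : ∀ᶠ t in nhds t₀, t ∈ U ∧ ‖B t‖₊ < ‖B t₀‖₊ + 1 :=
    Filter.Eventually.and (hU.mem_nhds ht₀) ((hB.continuousAt (hU.mem_nhds ht₀)).nnnorm.eventually_lt_const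
      (lt_add_one _))
  obtain ⟨ε, hε, hball⟩ := Metric.eventually_nhds_iff_ball.1 hbound
  rw [Real.ball_eq_Ioo] at hball
  have heq : EqOn m (fun _ ↦ 0) (Ioo (t₀ - ε) (t₀ + ε)) :=
    ODE_solution_unique_of_mem_Ioo (v := fun t x ↦ B t x) (s := fun _ ↦ univ)
      (K := ‖B t₀‖₊ + 1) (t₀ := t₀)
      (fun t ht ↦ ((B t).lipschitz.weaken (hball t ht).2.le).lipschitzOnWith)
      ⟨by linarith, by linarith⟩ (fun t ht ↦ ⟨hm t (hball t ht).1, trivial⟩)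
      (fun t _ ↦ ⟨by simpa using hasDerivAt_const t (0 : E), trivial⟩) h₀
  filter_upwards [Ioo_mem_nhds (show t₀ - ε < t₀ by linarith) (show t₀ < t₀ + ε by linarith)]
    with t ht using heq ht

end

/-! ### Zeros of null parallel fields -/

section

variable {E : Type*} [NormedAddCommGroup E] [NormedSpace ℝ E] [FiniteDimensional ℝ E]
  {M : Type*} [TopologicalSpace M] [ChartedSpace E M] [IsManifold 𝓘(ℝ, E) ∞ M]
  {N : Type*} [TopologicalSpace N] [ChartedSpace ℝ N] [IsManifold 𝓘(ℝ, ℝ) ∞ N]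
  {γ : N → M} {s₀ : N} {g : PseudoRiemannianMetric E M}
  {V : ∀ s : N, TangentSpace 𝓘(ℝ, ℝ) s}

/-- Parallelism is defined in a chart that moves with the point. Rewritten in the fixed chart at `γ
s₀`, it says that the components `m` of the field along the coordinate curve `c` solve `m' = -Γ(c')
m`, and `m` vanishes at the initial time. -/
theorem IsNullParallelField.eventually_eq_zero (hγ : ContMDiff 𝓘(ℝ, ℝ) 𝓘(ℝ, E) ∞ γ)
    (hinj : ∀ s, Function.Injective (pushforward (E := E) γ s))
    (hV : IsNullParallelField g γ V) (h : V s₀ = 0) : ∀ᶠ s in nhds s₀, V s = 0 := by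
  set x₁ := γ s₀
  have hx₁ : γ s₀ ∈ (extChartAt 𝓘(ℝ, E) x₁).source := mem_extChartAt_source x₁
  set ψ := extChartAt 𝓘(ℝ, ℝ) s₀
  set W := γ ⁻¹' (extChartAt 𝓘(ℝ, E) x₁).source
  have hW : IsOpen W := (isOpen_extChartAt_source x₁).preimage hγ.continuous
  set U := ψ.target ∩ ψ.symm ⁻¹' W
  have hU : IsOpen U := (continuousOn_extChartAt_symm s₀).isOpen_inter_preimage
    (isOpen_extChartAt_target s₀) hW
  have hU₀ : ψ s₀ ∈ U := ⟨mem_extChartAt_target s₀, by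
    rw [mem_preimage, extChartAt_to_inv]; exact hx₁⟩
  have hψ : ContMDiffOn 𝓘(ℝ, ℝ) 𝓘(ℝ, ℝ) ∞ ψ.symm U :=
    (contMDiffOn_extChartAt_symm s₀).mono inter_subset_left
  have hψd : ∀ t ∈ U, MDifferentiableAt 𝓘(ℝ, ℝ) 𝓘(ℝ, ℝ) ψ.symm t := fun t ht ↦
    (hψ.contMDiffAt (hU.mem_nhds ht)).mdifferentiableAt (by simp)
  set c : ℝ → E := fun t ↦ extChartAt 𝓘(ℝ, E) x₁ (γ (ψ.symm t))
  set m : ℝ → E := fun t ↦ tangentCoord E x₁ (γ (ψ.symm t))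
    (pushforward γ (ψ.symm t) (V (ψ.symm t)))
  set w : ∀ t, TangentSpace 𝓘(ℝ, ℝ) (ψ.symm t) := fun t ↦
    mfderiv 𝓘(ℝ, ℝ) 𝓘(ℝ, ℝ) ψ.symm t (1 : ℝ)
  have hcurve : ∀ t ∈ U, MDifferentiableAt 𝓘(ℝ, ℝ) 𝓘(ℝ, E)
      (fun s ↦ extChartAt 𝓘(ℝ, E) x₁ (γ s)) (ψ.symm t) := fun t ht ↦
    (mdifferentiableAt_extChartAt_of_mem ht.2).comp (ψ.symm t) (mdifferentiableAt_curve hγ)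
  have hc : ContDiffOn ℝ ∞ c U := fun t ht ↦
    (((contMDiffAt_extChartAt_of_mem ht.2).comp (ψ.symm t) hγ.contMDiffAt).comp t
      (hψ.contMDiffAt (hU.mem_nhds ht))).contDiffAt.contDiffWithinAt
  have hderiv : ∀ {f : N → E} {t : ℝ}, t ∈ U →
      MDifferentiableAt 𝓘(ℝ, ℝ) 𝓘(ℝ, E) f (ψ.symm t) →
      HasDerivAt (fun t ↦ f (ψ.symm t)) (mvfderiv 𝓘(ℝ, ℝ) f (ψ.symm t) (w t)) t := by
    intro f t ht hf
    obtain ⟨L, hL, hL₁⟩ : ∃ L : ℝ →L[ℝ] E, HasFDerivAt (fun t ↦ f (ψ.symm t)) L t ∧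
        L 1 = mvfderiv 𝓘(ℝ, ℝ) f (ψ.symm t) (w t) :=
      ⟨_, (hf.hasMFDerivAt.comp t (hψd t ht).hasMFDerivAt).hasFDerivAt, rfl⟩
    exact hL₁ ▸ hL.hasDerivAt
  have hcd : ∀ t ∈ U, deriv c t =
      tangentCoord E x₁ (γ (ψ.symm t)) (pushforward γ (ψ.symm t) (w t)) := fun t ht ↦ by
    rw [← mvfderiv_extChartAt_comp hγ ht.2]
    exact (hderiv ht (hcurve t ht)).deriv
  have hB : ContinuousOn (fun t ↦ -g.christoffel x₁ (c t) (deriv c t)) U :=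
    (((g.continuousOn_christoffel x₁).comp hc.continuousOn fun t ht ↦
      (extChartAt 𝓘(ℝ, E) x₁).map_source ht.2).clm_apply
        (hc.continuousOn_deriv_of_isOpen hU (by simp))).neg
  have hm : ∀ t ∈ U, HasDerivAt m ((-g.christoffel x₁ (c t) (deriv c t)) (m t)) t := by
    intro t ht
    have h₁ := covDerivAlong_transition g hγ (s₀ := ψ.symm t) (x₁ := x₁)
      (U := fun s ↦ pushforward γ s (V s))
      (hV.mdifferentiableAt hγ (mem_extChartAt_source _)) ht.2 (w t)
    rw [hV.parallel, map_zero, ← hcd t ht] at h₁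
    have h₂ := hderiv ht (hV.mdifferentiableAt hγ (x₁ := x₁) ht.2)
    rw [eq_neg_of_add_eq_zero_left h₁] at h₂
    exact h₂
  have hm₀ : m (ψ s₀) = 0 := by
    simp only [m]
    rw [extChartAt_to_inv, h, map_zero, map_zero]
  have hzero := (continuousAt_extChartAt (I := 𝓘(ℝ, ℝ)) s₀).eventually
    (eventually_eq_zero_of_linear_ode hU hU₀ hB hm hm₀)
  filter_upwards [hzero, extChartAt_source_mem_nhds (I := 𝓘(ℝ, ℝ)) s₀, hW.mem_nhds hx₁]
    with s hs hs' hsW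
  simp only [m] at hs
  rw [ψ.left_inv hs'] at hs
  exact hinj s (tangentCoord_injective hsW (by rw [hs, map_zero, map_zero]))

/-- A null parallel field which does not vanish at some point does not vanish anywhere. -/
theorem IsNullParallelField.ne_zero [ConnectedSpace N] (hγ : ContMDiff 𝓘(ℝ, ℝ) 𝓘(ℝ, E) ∞ γ)
    (hinj : ∀ s, Function.Injective (pushforward (E := E) γ s))
    (hV : IsNullParallelField g γ V) {s₁ : N} (h : V s₁ ≠ 0) (s : N) : V s ≠ 0 := by
  -- The zero set is open by uniqueness of solutions and closed by continuity, so it is all or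
  -- nothing on a connected curve.
  have hloc : IsLocallyConstant (fun s ↦ V s = 0) := by
    rw [IsLocallyConstant.iff_eventually_eq]
    intro s₀
    by_cases h₀ : V s₀ = 0
    · filter_upwards [hV.eventually_eq_zero hγ hinj h₀] with s hs
      simp only [hs, h₀]
    · have hx := mem_extChartAt_source (I := 𝓘(ℝ, E)) (γ s₀)
      have hne : tangentCoord E (γ s₀) (γ s₀) (pushforward γ s₀ (V s₀)) ≠ 0 := fun h ↦
        h₀ (hinj s₀ (tangentCoord_injective hx (by rw [h, map_zero, map_zero])))
      filter_upwards [(contMDiffAt_tangentCoord_pushforward hγ hV.smooth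
        hx).continuousAt.eventually_ne hne] with s hs
      have hs₀ : V s ≠ 0 := fun h ↦ hs (by rw [h, map_zero, map_zero])
      simp only [hs₀, h₀]
  have := hloc.apply_eq_of_isPreconnected isPreconnected_univ (mem_univ s) (mem_univ s₁)
  exact fun hs ↦ h (this.mp hs)

end

/-! ### Algebra of bivectors -/

section

variable {V : Type*} [AddCommGroup V] [Module ℝ V]

theorem bivectorComponent_wedge (v w : V) (α β : Module.Dual ℝ V) :
    bivectorComponent (exteriorPower.ιMulti ℝ 2 ![v, w]) α β = α v * β w - α w * β v := by
  rw [bivectorComponent, exteriorPower.alternatingMapToDual_apply_ιMulti, Matrix.det_fin_two]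
  simp
  ring

theorem coe_wedge (v w : V) :
    (exteriorPower.ιMulti ℝ 2 ![v, w] : ExteriorAlgebra ℝ V) =
      ExteriorAlgebra.ι ℝ v * ExteriorAlgebra.ι ℝ w := by
  simp [ExteriorAlgebra.ιMulti_apply]

theorem wedge_add_smul_left (v w : V) (r : ℝ) :
    exteriorPower.ιMulti ℝ 2 ![v, w + r • v] = exteriorPower.ιMulti ℝ 2 ![v, w] := by
  apply Subtype.ext
  rw [coe_wedge, coe_wedge, map_add, map_smul, mul_add, mul_smul_comm,
    ExteriorAlgebra.ι_sq_zero, smul_zero, add_zero]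

theorem wedge_smul_smul (v w : V) (r r' : ℝ) :
    exteriorPower.ιMulti ℝ 2 ![r • v, r' • w] =
      (r * r') • exteriorPower.ιMulti ℝ 2 ![v, w] := by
  apply Subtype.ext
  rw [Submodule.coe_smul, coe_wedge, coe_wedge, map_smul, map_smul, smul_mul_smul_comm]

theorem map_wedge {W : Type*} [AddCommGroup W] [Module ℝ W] (f : V →ₗ[ℝ] W) (v w : V) :
    exteriorPower.map 2 f (exteriorPower.ιMulti ℝ 2 ![v, w]) =
      exteriorPower.ιMulti ℝ 2 ![f v, f w] := by
  rw [exteriorPower.map_apply_ιMulti]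
  congr 1
  funext i
  fin_cases i <;> rfl

/-- Contraction lowers the degree by one: on a decomposable bivector it gives `d(v) w - d(w) v`, and
the rest is linearity. This produces the quotient in the division by a vector below. -/
theorem exists_contractLeft_eq_ι (d : Module.Dual ℝ V) (S : ⋀[ℝ]^2 V) :
    ∃ w : V, CliffordAlgebra.contractLeft (Q := (0 : QuadraticForm ℝ V)) d
      (S : ExteriorAlgebra ℝ V) = ExteriorAlgebra.ι ℝ w := by
  have hS : S ∈ Submodule.span ℝ (range (exteriorPower.ιMulti ℝ 2 (M := V))) := by
    rw [exteriorPower.ιMulti_span]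
    trivial
  induction hS using Submodule.span_induction with
  | mem S hS =>
    obtain ⟨v, rfl⟩ := hS
    have hv : v = ![v 0, v 1] := by
      funext i
      fin_cases i <;> rfl
    rw [hv, coe_wedge]
    refine ⟨d (v 0) • v 1 - d (v 1) • v 0, ?_⟩
    refine (CliffordAlgebra.contractLeft_ι_mul _ _ _).trans ?_
    rw [CliffordAlgebra.contractLeft_ι, map_sub, map_smul, map_smul,
      ← Algebra.commutes, ← Algebra.smul_def]
  | zero => exact ⟨0, by simp⟩
  | add S S' _ _ h h' =>
    obtain ⟨w, hw⟩ := h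
    obtain ⟨w', hw'⟩ := h'
    exact ⟨w + w', by rw [Submodule.coe_add, map_add, hw, hw', map_add]⟩
  | smul r S _ h =>
    obtain ⟨w, hw⟩ := h
    exact ⟨r • w, by rw [Submodule.coe_smul, map_smul, hw, map_smul]⟩

/-- A bivector annihilated by a nonzero vector `v` is divisible by `v`. -/
theorem exists_eq_wedge_of_ι_mul_eq_zero {v : V} {d : Module.Dual ℝ V} (hd : d v = 1)
    {S : ⋀[ℝ]^2 V} (h : ExteriorAlgebra.ι ℝ v * (S : ExteriorAlgebra ℝ V) = 0) :
    ∃ w : V, S = exteriorPower.ιMulti ℝ 2 ![v, w] := by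
  obtain ⟨w, hw⟩ := exists_contractLeft_eq_ι d S
  refine ⟨w, Subtype.ext ?_⟩
  -- Contraction is an antiderivation: `0 = d ⌟ (v ∧ S) = d(v) S - v ∧ (d ⌟ S)`, and `d(v) = 1`.
  have h₁ := CliffordAlgebra.contractLeft_ι_mul (Q := (0 : QuadraticForm ℝ V)) d v
    (S : ExteriorAlgebra ℝ V)
  have h₂ := congrArg (CliffordAlgebra.contractLeft (Q := (0 : QuadraticForm ℝ V)) d) h
  rw [map_zero] at h₂
  rw [coe_wedge, ← hw]
  have h₃ := h₁.symm.trans h₂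
  rw [hd, one_smul] at h₃
  exact sub_eq_zero.1 h₃

end

/-! ### Tractor fibres and their splittings -/

section

variable {E : Type*} [NormedAddCommGroup E] [NormedSpace ℝ E]
  {M : Type*} [TopologicalSpace M] [ChartedSpace E M] [IsManifold 𝓘(ℝ, E) ∞ M]
  {c : ConformalStructure E M} {x : M}

/-- On a nonzero space a nondegenerate form takes a nonzero value, from which `e^{2φ}` can be read
off. Uniqueness makes the chosen rescaling factors a cocycle, so that components given for one
metric extend consistently to the whole class. -/
theorem IsRescaling.unique [Nontrivial E] {g ĝ : PseudoRiemannianMetric E M} {φ φ' : M → ℝ}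
    (h : IsRescaling φ g ĝ) (h' : IsRescaling φ' g ĝ) : φ = φ' := by
  funext x
  obtain ⟨v, hv⟩ := exists_ne (0 : E)
  obtain ⟨w, hw⟩ : ∃ w : TangentSpace 𝓘(ℝ, E) x, g.val x v w ≠ 0 := by
    by_contra! hw
    exact hv (g.nondegenerate x v hw)
  have := mul_right_cancel₀ hw ((h.2 x v w).symm.trans (h'.2 x v w))
  linarith [Real.exp_injective this]

theorem IsRescaling.trans {g₁ g₂ g₃ : PseudoRiemannianMetric E M} {φ φ' : M → ℝ}
    (h : IsRescaling φ g₁ g₂) (h' : IsRescaling φ' g₂ g₃) : IsRescaling (φ + φ') g₁ g₃ := by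
  refine ⟨h.1.add h'.1, fun x v w ↦ ?_⟩
  rw [h'.2, h.2, ← mul_assoc, ← Real.exp_add, Pi.add_apply]
  ring_nf

/-- The rescaling factor from `g` to `ĝ` in a conformal structure. -/
def rescalingFactor (c : ConformalStructure E M) (g ĝ : c.metrics) : M → ℝ :=
  (c.related g.1 g.2 ĝ.1 ĝ.2).choose

theorem isRescaling_rescalingFactor (g ĝ : c.metrics) :
    IsRescaling (rescalingFactor c g ĝ) g.1 ĝ.1 :=
  (c.related g.1 g.2 ĝ.1 ĝ.2).choose_spec

theorem isRescaling_zero (g : PseudoRiemannianMetric E M) : IsRescaling 0 g g :=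
  ⟨contMDiff_const, fun x v w ↦ by simp⟩

theorem rescalingFactor_self [Nontrivial E] (g : c.metrics) : rescalingFactor c g g = 0 :=
  (isRescaling_rescalingFactor g g).unique (isRescaling_zero g.1)

theorem rescalingFactor_eq_add [Nontrivial E] (g : c.metrics) {g₁ g₂ : c.metrics} {φ : M → ℝ}
    (h : IsRescaling φ g₁.1 g₂.1) : rescalingFactor c g g₂ = rescalingFactor c g g₁ + φ :=
  (isRescaling_rescalingFactor g g₂).unique ((isRescaling_rescalingFactor g g₁).trans h)

theorem changeSplitting_apply (g : PseudoRiemannianMetric E M) (φ : M → ℝ)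
    (μ : TangentSpace 𝓘(ℝ, E) x) (ρ : ℝ) :
    changeSplitting g φ x (0, μ, ρ) =
      (0, Real.exp (-φ x) • μ, Real.exp (-φ x) * (ρ - mvfderiv 𝓘(ℝ, E) φ x μ)) := by
  simp [changeSplitting]

theorem split_eq_changeSplitting_comp {g ĝ : c.metrics} {φ : M → ℝ}
    (h : IsRescaling φ g.1 ĝ.1) : split c ĝ x = changeSplitting g.1 φ x ∘ₗ split c g x :=
  LinearMap.ext fun V ↦ V.2 g ĝ φ h

theorem split_injective (g : c.metrics) : Function.Injective (split c g x) := by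
  rw [injective_iff_map_eq_zero]
  intro V hV
  refine Subtype.ext (funext fun ĝ ↦ ?_)
  have h := V.2 g ĝ _ (isRescaling_rescalingFactor g ĝ)
  have hVg : V.1 g = 0 := hV
  rw [h, hVg, map_zero]
  rfl

theorem split_canonicalTractor (g : c.metrics) (ρ : densityFibre c (-1) x) :
    split c g x (canonicalTractor c x ρ) = (0, 0, ρ.1 g) := rfl

theorem exists_density_eq_one [Nontrivial E] (g : c.metrics) (x : M) :
    ∃ ρ : densityFibre c (-1) x, ρ.1 g = 1 := by
  refine ⟨⟨fun ĝ ↦ Real.exp (-rescalingFactor c g ĝ x), fun g₁ g₂ φ h ↦ ?_⟩, ?_⟩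
  · simp only [rescalingFactor_eq_add g h, Pi.add_apply]
    rw [← Real.exp_add]
    ring_nf
  · simp [rescalingFactor_self]

theorem exists_split_eq [Nontrivial E] (g : c.metrics) (μ : TangentSpace 𝓘(ℝ, E) x) :
    ∃ W : tractorFibre c x, split c g x W = (0, μ, 0) := by
  refine ⟨⟨fun ĝ ↦ changeSplitting g.1 (rescalingFactor c g ĝ) x (0, μ, 0),
    fun g₁ g₂ φ h ↦ ?_⟩, ?_⟩
  · have hd₁ : MDifferentiableAt 𝓘(ℝ, E) 𝓘(ℝ, ℝ) (rescalingFactor c g g₁) x :=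
      (isRescaling_rescalingFactor g g₁).1.contMDiffAt.mdifferentiableAt (by simp)
    have hd₂ : MDifferentiableAt 𝓘(ℝ, E) 𝓘(ℝ, ℝ) φ x :=
      h.1.contMDiffAt.mdifferentiableAt (by simp)
    simp only [changeSplitting_apply]
    rw [rescalingFactor_eq_add g h, mvfderiv_add hd₁ hd₂]
    simp only [Pi.add_apply, neg_add, Real.exp_add, add_apply, map_smul, smul_smul, smul_eq_mul]
    refine Prod.ext rfl (Prod.ext ?_ ?_)
    · simp only [mul_comm]
    · simp only
      ring
  · change changeSplitting g.1 (rescalingFactor c g g) x (0, μ, 0) = _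
    rw [changeSplitting_apply, rescalingFactor_self]
    simp

/-- Both factors scale by `e^{-φ}`. The change of splitting also adds a multiple of `X` to `Z_a
μ^a`, which the wedge with `X` removes. -/
theorem map_changeSplitting_wedge (g : PseudoRiemannianMetric E M) (φ : M → ℝ)
    (μ : TangentSpace 𝓘(ℝ, E) x) :
    exteriorPower.map 2 (changeSplitting g φ x)
        (exteriorPower.ιMulti ℝ 2 ![((0, 0, 1) : SplitTractor E x), (0, μ, 0)]) =
      exteriorPower.ιMulti ℝ 2
        ![((0, 0, 1) : SplitTractor E x), (0, Real.exp (-2 * φ x) • μ, 0)] := by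
  have h₁ : changeSplitting g φ x (0, 0, 1) = Real.exp (-φ x) • ((0, 0, 1) : SplitTractor E x) := by
    rw [changeSplitting_apply]
    simp
  have h₂ : changeSplitting g φ x (0, μ, 0) = Real.exp (-φ x) •
      (((0, μ, 0) : SplitTractor E x) +
        (-mvfderiv 𝓘(ℝ, E) φ x μ) • ((0, 0, 1) : SplitTractor E x)) := by
    rw [changeSplitting_apply]
    simp
  have h₃ : ((0, Real.exp (-2 * φ x) • μ, 0) : SplitTractor E x) =
      Real.exp (-2 * φ x) • ((0, μ, 0) : SplitTractor E x) := by simp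
  rw [map_wedge, h₁, h₂, wedge_smul_smul, wedge_add_smul_left, h₃,
    ← one_smul ℝ ((0, 0, 1) : SplitTractor E x), wedge_smul_smul, one_mul, ← Real.exp_add, one_smul]
  ring_nf

theorem IsIncident.exists_split_eq [Nontrivial E] {N : Type*} {γ : N → M}
    {S : BitractorAlong c γ} (h : IsIncident c γ S) (g : c.metrics) (s : N) :
    ∃ (σ : ℝ) (μ : TangentSpace 𝓘(ℝ, E) (γ s)),
      exteriorPower.map 2 (split c g (γ s)) (S s) =
        exteriorPower.ιMulti ℝ 2 ![((0, 0, 1) : SplitTractor E (γ s)), (σ, μ, 0)] := by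
  obtain ⟨ρ, hρ⟩ := exists_density_eq_one g (γ s)
  have hX : split c g (γ s) (canonicalTractor c (γ s) ρ) = (0, 0, 1) := by
    rw [split_canonicalTractor, hρ]
  -- The `ρ`-component is a functional equal to `1` on the canonical tractor of unit density, as the
  -- division by `X` requires.
  let d : Module.Dual ℝ (tractorFibre c (γ s)) :=
    LinearMap.snd ℝ _ ℝ ∘ₗ LinearMap.snd ℝ ℝ _ ∘ₗ split c g (γ s)
  have hd : d (canonicalTractor c (γ s) ρ) = 1 := by
    simp only [d, LinearMap.comp_apply, hX, LinearMap.snd_apply]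
  obtain ⟨W, hW⟩ := exists_eq_wedge_of_ι_mul_eq_zero hd (h s ρ)
  refine ⟨(split c g (γ s) W).1, (split c g (γ s) W).2.1, ?_⟩
  have hsplit : split c g (γ s) W = ((split c g (γ s) W).1, (split c g (γ s) W).2.1, 0) +
      (split c g (γ s) W).2.2 • ((0, 0, 1) : SplitTractor E (γ s)) := by
    simp
  rw [hW, map_wedge, hX, hsplit, wedge_add_smul_left]
  simp

end

/-! ### 2-tractors of the form `X ∧ Z_a u^a` -/

section

variable {E : Type*} [NormedAddCommGroup E] [NormedSpace ℝ E]
  {M : Type*} [TopologicalSpace M] [ChartedSpace E M] [IsManifold 𝓘(ℝ, E) ∞ M]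
  {N : Type*} [TopologicalSpace N] [ChartedSpace ℝ N]
  {c : ConformalStructure E M} {γ : N → M} {S S' : BitractorAlong c γ} {g : c.metrics}
  {V : ∀ s : N, TangentSpace 𝓘(ℝ, ℝ) s}

/-- `S = X ∧ Z_a u^a` in the splitting of `g`, where `u` is the push-forward of `V`. -/
def HasLeg (S : BitractorAlong c γ) (g : c.metrics) (V : ∀ s : N, TangentSpace 𝓘(ℝ, ℝ) s) : Prop :=
  ∀ s, exteriorPower.map 2 (split c g (γ s)) (S s) =
    exteriorPower.ιMulti ℝ 2 ![((0, 0, 1) : SplitTractor E (γ s)), (0, pushforward γ s (V s), 0)]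

theorem HasLeg.rescale (h : HasLeg S g V) {ĝ : c.metrics} {φ : M → ℝ}
    (hφ : IsRescaling φ g.1 ĝ.1) : HasLeg S ĝ (fun s ↦ Real.exp (-2 * φ (γ s)) • V s) := by
  intro s
  rw [split_eq_changeSplitting_comp hφ, exteriorPower.map_comp, LinearMap.comp_apply, h s,
    map_changeSplitting_wedge, map_smul]

theorem HasLeg.eq (h : HasLeg S g V) (h' : HasLeg S' g V) : S = S' :=
  funext fun s ↦ exteriorPower.map_injective_field (split_injective g) ((h s).trans (h' s).symm)

theorem HasLeg.smul (h : HasLeg S g V) (r : ℝ) : HasLeg (r • S) g (fun s ↦ r • V s) := by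
  intro s
  have hr : ((0, pushforward γ s (r • V s), 0) : SplitTractor E (γ s)) =
      r • ((0, pushforward γ s (V s), 0) : SplitTractor E (γ s)) := by simp
  rw [Pi.smul_apply, map_smul, h s, hr]
  have := wedge_smul_smul ((0, 0, 1) : SplitTractor E (γ s)) (0, pushforward γ s (V s), 0) 1 r
  rw [one_smul, one_mul] at this
  exact this.symm

theorem HasLeg.exists_tractor_eq [Nontrivial E] (h : HasLeg S g V) (s : N) :
    ∃ (ρ : densityFibre c (-1) (γ s)) (W : tractorFibre c (γ s)), ρ.1 g = 1 ∧
      split c g (γ s) W = (0, pushforward γ s (V s), 0) ∧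
      S s = exteriorPower.ιMulti ℝ 2 ![canonicalTractor c (γ s) ρ, W] := by
  obtain ⟨ρ, hρ⟩ := exists_density_eq_one g (γ s)
  obtain ⟨W, hW⟩ := exists_split_eq g (pushforward γ s (V s))
  refine ⟨ρ, W, hρ, hW, exteriorPower.map_injective_field (split_injective g) ?_⟩
  have hX : split c g (γ s) (canonicalTractor c (γ s) ρ) = (0, 0, 1) := by
    rw [split_canonicalTractor, hρ]
  rw [h s, map_wedge, hW, hX]

theorem exists_hasLeg [Nontrivial E] (c : ConformalStructure E M) (γ : N → M) (g : c.metrics)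
    (V : ∀ s : N, TangentSpace 𝓘(ℝ, ℝ) s) : ∃ S : BitractorAlong c γ, HasLeg S g V := by
  choose ρ hρ using fun s ↦ exists_density_eq_one g (γ s)
  choose W hW using fun s ↦ exists_split_eq g (pushforward γ s (V s))
  refine ⟨fun s ↦ exteriorPower.ιMulti ℝ 2 ![canonicalTractor c (γ s) (ρ s), W s], fun s ↦ ?_⟩
  have hX : split c g (γ s) (canonicalTractor c (γ s) (ρ s)) = (0, 0, 1) := by
    rw [split_canonicalTractor, hρ]
  rw [map_wedge, hW, hX]

theorem HasLeg.isIncident [Nontrivial E] (h : HasLeg S g V) : IsIncident c γ S := by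
  intro s τ
  obtain ⟨ρ, W, hρ, -, hS⟩ := h.exists_tractor_eq s
  have hτ : canonicalTractor c (γ s) τ = τ.1 g • canonicalTractor c (γ s) ρ := by
    apply split_injective g
    rw [map_smul]
    rw [split_canonicalTractor, split_canonicalTractor, hρ]
    simp
  rw [hτ, hS, coe_wedge, ← mul_assoc, map_smul, smul_mul_assoc, ExteriorAlgebra.ι_sq_zero,
    smul_zero, zero_mul]

/-- All four pairings of the tractor metric on the factors `X` and `W` vanish; the image of the
endomorphism lies in their span, on which it is zero. -/
theorem HasLeg.isTotallyNull [FiniteDimensional ℝ E] [Nontrivial E] (h : HasLeg S g V)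
    (hV : ∀ s, g.1.val (γ s) (pushforward γ s (V s)) (pushforward γ s (V s)) = 0) :
    IsTotallyNull c γ S := by
  intro s
  obtain ⟨ρ, W, hρ, hW, hS⟩ := h.exists_tractor_eq s
  set X := canonicalTractor c (γ s) ρ
  have hX : split c g (γ s) X = (0, 0, 1) := by
    rw [split_canonicalTractor, hρ]
  have hXX : tractorMetric c (γ s) X X = 0 := by
    rw [tractorMetric_eq c _ g, hX]
    simp [splitMetric]
  have hXW : tractorMetric c (γ s) X W = 0 := by
    rw [tractorMetric_eq c _ g, hX, hW]
    simp [splitMetric]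
  have hWX : tractorMetric c (γ s) W X = 0 := by
    rw [tractorMetric_eq c _ g, hX, hW]
    simp [splitMetric]
  have hWW : tractorMetric c (γ s) W W = 0 := by
    rw [tractorMetric_eq c _ g, hW]
    simp [splitMetric, hV s]
  ext z : 1
  rw [hS, LinearMap.comp_apply, bivectorEnd_wedge, bivectorEnd_wedge]
  simp only [map_sub, map_smul, hXX, hXW, hWX, hWW, smul_zero, sub_zero, zero_smul,
    LinearMap.zero_apply]

end

theorem forall_pos_or_forall_neg {N : Type*} [TopologicalSpace N] [ConnectedSpace N]
    {f : N → ℝ} (hf : Continuous f)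
    (h : ∀ s, f s ≠ 0) : (∀ s, 0 < f s) ∨ ∀ s, f s < 0 := by
  by_contra! hcon
  obtain ⟨⟨a, ha⟩, ⟨b, hb⟩⟩ := hcon
  obtain ⟨s, hs⟩ := mem_range_of_exists_le_of_exists_ge hf ⟨a, ha⟩ ⟨b, hb⟩
  exact h s hs

/-! ### Components of 2-tractors and the connection form -/

section

variable {E : Type*} [NormedAddCommGroup E] [NormedSpace ℝ E]
  {M : Type*} [TopologicalSpace M] [ChartedSpace E M]

theorem wedge_ne_zero {x : M} {μ : TangentSpace 𝓘(ℝ, E) x} (hμ : μ ≠ 0) :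
    exteriorPower.ιMulti ℝ 2 ![((0, 0, 1) : SplitTractor E x), (0, μ, 0)] ≠ 0 := by
  intro h
  refine hμ ((Module.forall_dual_apply_eq_zero_iff ℝ μ).1 fun l ↦ ?_)
  have h₁ := bivectorComponent_wedge ((0, 0, 1) : SplitTractor E x) (0, μ, 0)
    (LinearMap.snd ℝ _ ℝ ∘ₗ LinearMap.snd ℝ ℝ _) (l ∘ₗ LinearMap.fst ℝ _ ℝ ∘ₗ LinearMap.snd ℝ ℝ _)
  rw [h] at h₁
  simpa [bivectorComponent] using h₁.symm

variable [IsManifold 𝓘(ℝ, E) ∞ M]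
  {N : Type*} {c : ConformalStructure E M} {γ : N → M} {S : BitractorAlong c γ} {g : c.metrics}

theorem component_of_split_eq {s : N} {σ : ℝ} {μ : TangentSpace 𝓘(ℝ, E) (γ s)}
    (h : exteriorPower.map 2 (split c g (γ s)) (S s) =
      exteriorPower.ιMulti ℝ 2 ![((0, 0, 1) : SplitTractor E (γ s)), (σ, μ, 0)])
    (x₀ : M) (α β : Module.Dual ℝ (ℝ × E × ℝ)) :
    component c γ S g x₀ α β s =
      α (0, 0, 1) * β (σ, tangentCoord E x₀ (γ s) μ, 0) -
        α (σ, tangentCoord E x₀ (γ s) μ, 0) * β (0, 0, 1) := by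
  rw [component, coordSplit, exteriorPower.map_comp, LinearMap.comp_apply, h, map_wedge,
    bivectorComponent_wedge]
  simp

theorem connectionForm_apply [FiniteDimensional ℝ E] (g : PseudoRiemannianMetric E M) (x₀ : M)
    (u m : E) (a r : ℝ) :
    connectionForm g x₀ u (a, m, r) =
      (-(g.coordMetric x₀ (extChartAt 𝓘(ℝ, E) x₀ x₀) u m),
        g.christoffel x₀ (extChartAt 𝓘(ℝ, E) x₀ x₀) u m + r • u +
          a • g.raise x₀ (extChartAt 𝓘(ℝ, E) x₀ x₀)
            (g.schouten x₀ (extChartAt 𝓘(ℝ, E) x₀ x₀)) u,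
        -(g.schouten x₀ (extChartAt 𝓘(ℝ, E) x₀ x₀) u m)) := rfl

end

/-! ### Parallel 2-tractors and null parallel fields -/

section

variable {E : Type*} [NormedAddCommGroup E] [NormedSpace ℝ E]
  {M : Type*} [TopologicalSpace M] [ChartedSpace E M] [IsManifold 𝓘(ℝ, E) ∞ M]
  {N : Type*} [TopologicalSpace N] [ChartedSpace ℝ N]
  {c : ConformalStructure E M} {γ : N → M} {S : BitractorAlong c γ} {g : c.metrics}
  {V o : ∀ s : N, TangentSpace 𝓘(ℝ, ℝ) s}

theorem HasLeg.component_eq (h : HasLeg S g V) (x₀ : M) (α β : Module.Dual ℝ (ℝ × E × ℝ)) (s : N) :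
    component c γ S g x₀ α β s =
      α (0, 0, 1) * β (0, tangentCoord E x₀ (γ s) (pushforward γ s (V s)), 0) -
        α (0, tangentCoord E x₀ (γ s) (pushforward γ s (V s)), 0) * β (0, 0, 1) :=
  component_of_split_eq (h s) x₀ α β

theorem HasLeg.eq_zero_of_forall (h : HasLeg S g V) (hV : ∀ s, V s = 0) : S = 0 := by
  refine h.eq (g := g) (V := V) fun s ↦ ?_
  have h₁ := wedge_smul_smul ((0, 0, 1) : SplitTractor E (γ s)) 0 1 0
  have h0 : ((0, 0, 0) : SplitTractor E (γ s)) = 0 := rfl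
  rw [mul_zero, zero_smul, one_smul, zero_smul] at h₁
  rw [hV, map_zero, h0, h₁, Pi.zero_apply, map_zero]

theorem HasLeg.isCompatible (h : HasLeg S g V) (hV : ∀ s, ∃ r : ℝ, 0 < r ∧ V s = r • o s) :
    IsCompatible c γ o S := by
  intro ĝ s
  obtain ⟨r, hr, hrs⟩ := hV s
  have h₁ := h.rescale (isRescaling_rescalingFactor g ĝ) s
  set a := Real.exp (-2 * rescalingFactor c g ĝ (γ s))
  refine ⟨a * r, mul_pos (Real.exp_pos _) hr, ?_⟩
  have h₂ := wedge_smul_smul ((0, 0, 1) : SplitTractor E (γ s)) (0, pushforward γ s (o s), 0) 1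
    (a * r)
  rw [one_smul, one_mul] at h₂
  simp only [hrs, smul_smul, map_smul] at h₁
  rw [h₁, ← h₂]
  simp [a]

/-- A parallel incident 2-tractor has the form `X ∧ Z_a u^a` for a tangent vector field `u`
along the curve. -/
theorem IsIncidentParallel.exists_hasLeg [FiniteDimensional ℝ E] [Nontrivial E]
    (hS : IsIncidentParallel c γ S)
    (hinj : ∀ s, Function.Injective (pushforward (E := E) γ s)) (ho : ∀ s, o s ≠ 0)
    (g : c.metrics) : ∃ f : N → ℝ, HasLeg S g (fun s ↦ f s • o s) := by
  choose σ μ hσμ using fun s ↦ hS.incident.exists_split_eq g s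
  have hform : ∀ s, σ s = 0 ∧ ∃ r : ℝ, μ s = r • pushforward γ s (o s) := by
    intro s
    have hx : γ s ∈ (extChartAt 𝓘(ℝ, E) (γ s)).source := mem_extChartAt_source (γ s)
    set u := tangentCoord E (γ s) (γ s) (pushforward γ s (o s)) with hu
    set m := tangentCoord E (γ s) (γ s) (μ s) with hm
    have hu₀ : u ≠ 0 := fun h ↦
      ho s (hinj s (tangentCoord_injective hx (by rw [← hu, h, map_zero, map_zero])))
    obtain ⟨l₀, hl₀⟩ : ∃ l₀ : Module.Dual ℝ E, l₀ u = 1 := Module.Projective.exists_dual_eq_one ℝ hu₀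
    let τ : Module.Dual ℝ (ℝ × E × ℝ) := LinearMap.fst ℝ ℝ (E × ℝ)
    let ζ : Module.Dual ℝ E → Module.Dual ℝ (ℝ × E × ℝ) := fun l ↦
      l ∘ₗ LinearMap.fst ℝ E ℝ ∘ₗ LinearMap.snd ℝ ℝ (E × ℝ)
    -- Covectors annihilating `X` see only zero along the curve, so nothing is differentiated and
    -- the parallel equation reduces to `α(Z_u) β(W) - α(W) β(Z_u) = 0`, where `W = (σ, μ, 0)`.
    -- Pairing `τ` with `ζ l₀` gives `σ = 0`; pairing `ζ l₀` with `ζ l` gives `μ = l₀(μ) u`.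
    have hzero : ∀ α β : Module.Dual ℝ (ℝ × E × ℝ), α (0, 0, 1) = 0 → β (0, 0, 1) = 0 →
        component c γ S g (γ s) α β = fun _ ↦ 0 := by
      intro α β hα hβ
      funext t
      rw [component_of_split_eq (hσμ t), hα, hβ, zero_mul, mul_zero, sub_zero]
    have hσ : σ s = 0 := by
      have h := hS.parallel g s (o s) τ (ζ l₀)
      simp only [tractorDerivComponent] at h
      rw [hzero τ (ζ l₀) (by simp [τ]) (by simp [ζ]), mvfderiv_const,
        component_of_split_eq (hσμ s), component_of_split_eq (hσμ s)] at h
      simp only [LinearMap.comp_apply, connectionForm_apply, ← hu] at h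
      simpa [τ, ζ, hl₀] using h
    refine ⟨hσ, l₀ m, tangentCoord_injective hx ?_⟩
    rw [map_smul, ← hu, ← hm, ← sub_eq_zero]
    refine (Module.forall_dual_apply_eq_zero_iff ℝ _).1 fun l ↦ ?_
    have h := hS.parallel g s (o s) (ζ l₀) (ζ l)
    simp only [tractorDerivComponent] at h
    rw [hzero (ζ l₀) (ζ l) (by simp [ζ]) (by simp [ζ]), mvfderiv_const,
      component_of_split_eq (hσμ s), component_of_split_eq (hσμ s)] at h
    simp only [LinearMap.comp_apply, connectionForm_apply, ← hu, ← hm] at h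
    simp [ζ, hl₀] at h
    rw [map_sub, map_smul, smul_eq_mul]
    linarith
  choose hσ f hf using hform
  refine ⟨f, fun s ↦ ?_⟩
  rw [hσμ s, hσ s, hf s, map_smul]

/-- The linear form `m ↦ α(X) β(0, m, 0) - α(0, m, 0) β(X)`. -/
def legForm [FiniteDimensional ℝ E] (α β : Module.Dual ℝ (ℝ × E × ℝ)) : E →L[ℝ] ℝ :=
  LinearMap.toContinuousLinearMap
    ((α (0, 0, 1) • β - β (0, 0, 1) • α) ∘ₗ LinearMap.inr ℝ ℝ (E × ℝ) ∘ₗ LinearMap.inl ℝ E ℝ)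

theorem legForm_apply [FiniteDimensional ℝ E] (α β : Module.Dual ℝ (ℝ × E × ℝ)) (m : E) :
    legForm α β m = α (0, 0, 1) * β (0, m, 0) - α (0, m, 0) * β (0, 0, 1) := by
  simp [legForm, mul_comm]

theorem HasLeg.component_eq_legForm [FiniteDimensional ℝ E] (h : HasLeg S g V) (x₀ : M)
    (α β : Module.Dual ℝ (ℝ × E × ℝ)) :
    component c γ S g x₀ α β =
      fun s ↦ legForm α β (tangentCoord E x₀ (γ s) (pushforward γ s (V s))) := by
  funext s
  rw [h.component_eq, legForm_apply]

variable [IsManifold 𝓘(ℝ, ℝ) ∞ N]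

/-- Every tangent vector of the curve is a multiple of the velocity, so the two conditions in the
direction `u` give those in all directions `v`. -/
theorem IsOrientedNullGeodesic.exists_isNullParallelField {g : PseudoRiemannianMetric E M}
    (h : IsOrientedNullGeodesic g γ o) :
    ∃ V : ∀ s : N, TangentSpace 𝓘(ℝ, ℝ) s, IsNullParallelField g γ V ∧ (∀ s, V s ≠ 0) ∧
      ∀ s, ∃ r : ℝ, 0 < r ∧ V s = r • o s := by
  obtain ⟨u, hu, huo, hnull, hpar⟩ := h
  refine ⟨u, ⟨hu.1, fun s v ↦ ?_, fun s v ↦ ?_⟩, hu.2, huo⟩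
  · obtain ⟨r, rfl⟩ := eq_smul_of_ne_zero (v := v) (hu.2 s)
    rw [map_smul, map_smul, smul_apply, hnull, smul_zero]
  · obtain ⟨r, rfl⟩ := eq_smul_of_ne_zero (v := v) (hu.2 s)
    rw [covDerivAlong_smul, hpar, smul_zero]

theorem IsNullParallelField.isOrientedNullGeodesic {g : PseudoRiemannianMetric E M}
    (hV : IsNullParallelField g γ V) (hV₀ : ∀ s, V s ≠ 0)
    (hVo : ∀ s, ∃ r : ℝ, 0 < r ∧ V s = r • o s) : IsOrientedNullGeodesic g γ o :=
  ⟨V, ⟨hV.smooth, hV₀⟩, hVo, fun s ↦ hV.null s _, fun s ↦ hV.parallel s _⟩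


theorem IsNullParallelField.const_smul {g : PseudoRiemannianMetric E M}
    (hγ : ContMDiff 𝓘(ℝ, ℝ) 𝓘(ℝ, E) ∞ γ) (hV : IsNullParallelField g γ V) (r : ℝ) :
    IsNullParallelField g γ (fun s ↦ r • V s) where
  smooth := hV.smooth.smul (f := fun _ ↦ r) contMDiff_const
  null s v := by rw [map_smul, map_smul, hV.null, smul_zero]
  parallel s v := by
    rw [covDerivAlong_pushforward_smul hγ hV.smooth (f := fun _ ↦ r) mdifferentiableAt_const,
      hV.parallel, mvfderiv_const]
    simp

/-- Null geodesics are conformally invariant: `e^{-2φ} u` is parallel for `e^{2φ} g` if `u` is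
parallel for `g`. -/
theorem IsNullParallelField.rescale [FiniteDimensional ℝ E] {g ĝ : PseudoRiemannianMetric E M}
    {φ : M → ℝ} (hφ : IsRescaling φ g ĝ) (hγ : ContMDiff 𝓘(ℝ, ℝ) 𝓘(ℝ, E) ∞ γ)
    (hV : IsNullParallelField g γ V) :
    IsNullParallelField ĝ γ (fun s ↦ Real.exp (-2 * φ (γ s)) • V s) := by
  have hφγ : ContMDiff 𝓘(ℝ, ℝ) 𝓘(ℝ, ℝ) ∞ (fun s ↦ φ (γ s)) := hφ.1.comp hγ
  have hexp : ContDiff ℝ ∞ (fun t : ℝ ↦ Real.exp (-2 * t)) := by fun_prop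
  have hf : ContMDiff 𝓘(ℝ, ℝ) 𝓘(ℝ, ℝ) ∞ (fun s ↦ Real.exp (-2 * φ (γ s))) :=
    hexp.contMDiff.comp hφγ
  refine ⟨hV.smooth.smul hf, fun s v ↦ ?_, fun s v ↦ ?_⟩
  · rw [hφ.2, map_smul, map_smul, hV.null, smul_zero, mul_zero]
  have hx : γ s ∈ (extChartAt 𝓘(ℝ, E) (γ s)).source := mem_extChartAt_source (γ s)
  rw [covDerivAlong_pushforward_smul hγ hV.smooth (hf.mdifferentiable (by simp) s)]
  by_cases hv : v = 0
  · simp [hv, covDerivAlong]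
  obtain ⟨r, hr⟩ := eq_smul_of_ne_zero (v := V s) hv
  have hnull := hV.null s v
  rw [← g.coordMetric_tangentCoord hx] at hnull
  have hpar := hV.parallel s v
  rw [covDerivAlong] at hpar ⊢
  rw [g.christoffel_of_isRescaling hφ ((extChartAt 𝓘(ℝ, E) (γ s)).map_source hx) hnull]
  set dφ := fderiv ℝ (φ ∘ (extChartAt 𝓘(ℝ, E) (γ s)).symm) (extChartAt 𝓘(ℝ, E) (γ s) (γ s))
  set u := tangentCoord E (γ s) (γ s) (pushforward γ s v)
  have hVu : tangentCoord E (γ s) (γ s) (pushforward γ s (V s)) = r • u := by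
    rw [hr, map_smul, map_smul]
  have hdφ : mvfderiv 𝓘(ℝ, ℝ) (fun s ↦ φ (γ s)) s v = dφ u := by
    have hev : (fun s ↦ φ (γ s)) =ᶠ[nhds s] fun t ↦
        (φ ∘ (extChartAt 𝓘(ℝ, E) (γ s)).symm) (extChartAt 𝓘(ℝ, E) (γ s) (γ t)) := by
      filter_upwards [eventually_mem_source hγ hx] with t ht
      rw [Function.comp_apply, (extChartAt 𝓘(ℝ, E) (γ s)).left_inv ht]
    have hd := differentiableAt_comp_extChartAt_symm
      (hφ.1.contMDiffAt.mdifferentiableAt (x := γ s) (by simp))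
    have hy : MDifferentiableAt 𝓘(ℝ, ℝ) 𝓘(ℝ, E) (fun t ↦ extChartAt 𝓘(ℝ, E) (γ s) (γ t)) s :=
      (mdifferentiableAt_extChartAt_of_mem hx).comp s (mdifferentiableAt_curve hγ)
    rw [mvfderiv_congr hev]
    refine (mvfderiv_comp_fderiv (f := fun t ↦ extChartAt 𝓘(ℝ, E) (γ s) (γ t)) hd hy v).trans ?_
    rw [mvfderiv_extChartAt_comp hγ hx]
  have hdf : mvfderiv 𝓘(ℝ, ℝ) (fun s ↦ Real.exp (-2 * φ (γ s))) s v =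
      -2 * Real.exp (-2 * φ (γ s)) * dφ u := by
    refine (mvfderiv_comp_fderiv (φ := fun t : ℝ ↦ Real.exp (-2 * t)) (f := fun s ↦ φ (γ s))
      (hexp.differentiable (by simp) _) (hφγ.mdifferentiable (by simp) s) v).trans ?_
    rw [hdφ]
    have h := ((hasDerivAt_id (φ (γ s))).const_mul (-2 : ℝ)).exp.hasFDerivAt.fderiv
    simp only [id] at h
    rw [h]
    simp
    ring
  rw [hdf, ← add_assoc, ← add_assoc, hpar, hVu, map_smul, zero_add, smul_eq_mul]
  -- The Christoffel change contributes `2 r dφ(u) u` times `e^{-2φ}`, and the derivative of the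
  -- factor `e^{-2φ}` contributes the opposite; this fixes the exponent `-2`.
  module

variable [FiniteDimensional ℝ E]

theorem HasLeg.contMDiffAt_component (hγ : ContMDiff 𝓘(ℝ, ℝ) 𝓘(ℝ, E) ∞ γ) (h : HasLeg S g V)
    (hV : IsSmoothField V) (s₀ : N) (α β : Module.Dual ℝ (ℝ × E × ℝ)) :
    ContMDiffAt 𝓘(ℝ, ℝ) 𝓘(ℝ, ℝ) ∞ (component c γ S g (γ s₀) α β) s₀ := by
  rw [h.component_eq_legForm]
  exact (legForm α β).contDiff.contMDiff.contMDiffAt.comp s₀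
    (contMDiffAt_tangentCoord_pushforward hγ hV (mem_extChartAt_source (γ s₀)))

/-- The tractor derivative of a 2-tractor `X ∧ Z_a u^a` in the splitting of `g`. -/
theorem HasLeg.tractorDerivComponent_eq (hγ : ContMDiff 𝓘(ℝ, ℝ) 𝓘(ℝ, E) ∞ γ) (h : HasLeg S g V)
    (hV : IsSmoothField V) (s₀ : N) (v : TangentSpace 𝓘(ℝ, ℝ) s₀)
    (α β : Module.Dual ℝ (ℝ × E × ℝ)) :
    let u := tangentCoord E (γ s₀) (γ s₀) (pushforward γ s₀ v)
    let m := tangentCoord E (γ s₀) (γ s₀) (pushforward γ s₀ (V s₀))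
    tractorDerivComponent c γ S g s₀ v α β =
      legForm α β (covDerivAlong g.1 γ (fun s ↦ pushforward γ s (V s)) s₀ v) +
        (α (0, u, 0) * β (0, m, 0) - α (0, m, 0) * β (0, u, 0)) -
        g.1.val (γ s₀) (pushforward γ s₀ v) (pushforward γ s₀ (V s₀)) *
          (α (0, 0, 1) * β (1, 0, 0) - α (1, 0, 0) * β (0, 0, 1)) := by
  intro u m
  have hx : γ s₀ ∈ (extChartAt 𝓘(ℝ, E) (γ s₀)).source := mem_extChartAt_source (γ s₀)
  have hd : MDifferentiableAt 𝓘(ℝ, ℝ) 𝓘(ℝ, E)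
      (fun s ↦ tangentCoord E (γ s₀) (γ s) (pushforward γ s (V s))) s₀ :=
    (contMDiffAt_tangentCoord_pushforward hγ hV hx).mdifferentiableAt (by simp)
  have hmv := mvfderiv_comp_fderiv (φ := legForm α β) (legForm α β).differentiableAt hd v
  rw [ContinuousLinearMap.fderiv] at hmv
  -- Splitting into the `Y`, `Z` and `X` slots isolates the Schouten terms: both are multiples of
  -- `α(X) β(X)` and cancel by antisymmetry.
  have hdecomp : ∀ (δ : Module.Dual ℝ (ℝ × E × ℝ)) (a r : ℝ) (w : E),
      δ (a, w, r) = a * δ (1, 0, 0) + δ (0, w, 0) + r * δ (0, 0, 1) := by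
    intro δ a r w
    rw [← smul_eq_mul, ← smul_eq_mul, ← map_smul, ← map_smul, ← map_add, ← map_add]
    simp
  simp only [tractorDerivComponent]
  rw [h.component_eq, h.component_eq, h.component_eq_legForm, hmv, covDerivAlong, map_add,
    ← g.1.coordMetric_tangentCoord hx]
  simp only [LinearMap.comp_apply, connectionForm_apply, map_zero, zero_smul, add_zero, one_smul,
    zero_add, neg_zero]
  rw [hdecomp α (-_), hdecomp β (-_), legForm_apply α β (g.1.christoffel _ _ _ _)]
  simp only [u, m]
  ring

theorem HasLeg.tractorDerivComponent_eq_zero (hγ : ContMDiff 𝓘(ℝ, ℝ) 𝓘(ℝ, E) ∞ γ)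
    (h : HasLeg S g V) (hV : IsNullParallelField g.1 γ V) (s₀ : N)
    (v : TangentSpace 𝓘(ℝ, ℝ) s₀) (α β : Module.Dual ℝ (ℝ × E × ℝ)) :
    tractorDerivComponent c γ S g s₀ v α β = 0 := by
  rw [h.tractorDerivComponent_eq hγ hV.smooth, hV.parallel, hV.null, map_zero]
  by_cases hv : v = 0
  · have h0 : ((0, 0, 0) : ℝ × E × ℝ) = 0 := rfl
    simp [hv, h0]
  obtain ⟨r, hr⟩ := eq_smul_of_ne_zero (v := V s₀) hv
  have hsmul : ∀ (δ : Module.Dual ℝ (ℝ × E × ℝ)) (m : E), δ (0, r • m, 0) = r * δ (0, m, 0) := by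
    intro δ m
    rw [← smul_eq_mul, ← map_smul]
    simp
  rw [hr, map_smul, map_smul, hsmul, hsmul]
  ring

theorem HasLeg.isIncidentParallel [Nontrivial E] (hγ : ContMDiff 𝓘(ℝ, ℝ) 𝓘(ℝ, E) ∞ γ)
    (hinj : ∀ s, Function.Injective (pushforward (E := E) γ s))
    (h : HasLeg S g V) (hV : IsNullParallelField g.1 γ V) {s₀ : N} (hs₀ : V s₀ ≠ 0) :
    IsIncidentParallel c γ S where
  smooth ĝ s α β :=
    have hφ := isRescaling_rescalingFactor g ĝ
    (h.rescale hφ).contMDiffAt_component hγ (hV.rescale hφ hγ).smooth s α β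
  ne_zero hS := by
    have h₁ := h s₀
    rw [hS, Pi.zero_apply, map_zero] at h₁
    exact wedge_ne_zero (fun h₂ ↦ hs₀ (hinj s₀ (h₂.trans (map_zero _).symm))) h₁.symm
  parallel ĝ s v α β :=
    have hφ := isRescaling_rescalingFactor g ĝ
    (h.rescale hφ).tractorDerivComponent_eq_zero hγ (hV.rescale hφ hγ) s v α β
  incident := h.isIncident

/-- The derivative formula is read off slot by slot: the pair `τ`, `η` extracts `g(v, V)`, and the
pairs `η`, `ζ l` extract `∇_v V`. The components on `η`, `ζ l` also show that `f` is smooth, which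
the formula presupposes. -/
theorem IsIncidentParallel.exists_isNullParallelField [Nontrivial E]
    (hγ : ContMDiff 𝓘(ℝ, ℝ) 𝓘(ℝ, E) ∞ γ)
    (hinj : ∀ s, Function.Injective (pushforward (E := E) γ s)) (ho : IsVelocityField o)
    (hS : IsIncidentParallel c γ S) (g : c.metrics) :
    ∃ f : N → ℝ, ContMDiff 𝓘(ℝ, ℝ) 𝓘(ℝ, ℝ) ∞ f ∧ HasLeg S g (fun s ↦ f s • o s) ∧
      IsNullParallelField g.1 γ (fun s ↦ f s • o s) := by
  obtain ⟨f, hleg⟩ := hS.exists_hasLeg hinj ho.2 g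
  let τ : Module.Dual ℝ (ℝ × E × ℝ) := LinearMap.fst ℝ ℝ (E × ℝ)
  let ζ : Module.Dual ℝ E → Module.Dual ℝ (ℝ × E × ℝ) := fun l ↦
    l ∘ₗ LinearMap.fst ℝ E ℝ ∘ₗ LinearMap.snd ℝ ℝ (E × ℝ)
  let η : Module.Dual ℝ (ℝ × E × ℝ) := LinearMap.snd ℝ E ℝ ∘ₗ LinearMap.snd ℝ ℝ (E × ℝ)
  have hf : ContMDiff 𝓘(ℝ, ℝ) 𝓘(ℝ, ℝ) ∞ f := by
    refine contMDiff_of_smul_field hγ hinj ho.1 ho.2 fun s₀ l ↦ ?_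
    have h := hS.smooth g s₀ η (ζ l)
    rw [hleg.component_eq_legForm] at h
    simpa [legForm_apply, η, ζ] using h
  have hV : IsSmoothField (fun s ↦ f s • o s) := IsSmoothField.smul ho.1 hf
  refine ⟨f, hf, hleg, hV, fun s v ↦ ?_, fun s v ↦ ?_⟩
  · have h := hS.parallel g s v τ η
    rw [hleg.tractorDerivComponent_eq hγ hV] at h
    simpa [legForm_apply, τ, η] using h
  · refine (Module.forall_dual_apply_eq_zero_iff ℝ _).1 fun l ↦ ?_
    have h := hS.parallel g s v η (ζ l)
    rw [hleg.tractorDerivComponent_eq hγ hV] at h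
    simpa [legForm_apply, ζ, η] using h

theorem IsIncidentParallel.isOrientedNullGeodesic [Nontrivial E] [ConnectedSpace N]
    (hγ : ContMDiff 𝓘(ℝ, ℝ) 𝓘(ℝ, E) ∞ γ)
    (hinj : ∀ s, Function.Injective (pushforward (E := E) γ s)) (ho : IsVelocityField o)
    (hS : IsIncidentParallel c γ S) (g : c.metrics) : IsOrientedNullGeodesic g.1 γ o := by
  obtain ⟨f, hf, hleg, hV⟩ := hS.exists_isNullParallelField hγ hinj ho g
  obtain ⟨s₁, hs₁⟩ : ∃ s, f s • o s ≠ 0 := by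
    by_contra! h
    exact hS.ne_zero (hleg.eq_zero_of_forall h)
  have hV₀ : ∀ s, f s • o s ≠ 0 := hV.ne_zero hγ hinj hs₁
  have hf₀ : ∀ s, f s ≠ 0 := fun s hs ↦ hV₀ s (by rw [hs, zero_smul])
  -- The sign of `Σ` is not prescribed; when it opposes the orientation, `-V` is the geodesic
  -- velocity.
  rcases forall_pos_or_forall_neg hf.continuous hf₀ with hpos | hneg
  · exact hV.isOrientedNullGeodesic hV₀ fun s ↦ ⟨f s, hpos s, rfl⟩
  · exact (hV.const_smul hγ (-1)).isOrientedNullGeodesic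
      (fun s ↦ smul_ne_zero (by norm_num) (hV₀ s))
      fun s ↦ ⟨-f s, neg_pos.2 (hneg s), by rw [smul_smul, neg_one_mul]⟩

end

end ConformalTractor

end

/-! ### The main theorem -/

open ConformalTractor in
/-- Characterisation of unparametrised oriented null geodesics by parallel 2-tractors. -/
theorem theorem1p2
    {E : Type*} [NormedAddCommGroup E] [NormedSpace ℝ E] [FiniteDimensional ℝ E]
    (hdim : 3 ≤ Module.finrank ℝ E)
    {M : Type*} [TopologicalSpace M] [T2Space M] [SecondCountableTopology M]
    [ChartedSpace E M] [IsManifold 𝓘(ℝ, E) ∞ M]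
    (c : ConformalStructure E M)
    {N : Type*} [TopologicalSpace N] [ConnectedSpace N]
    [ChartedSpace ℝ N] [IsManifold 𝓘(ℝ, ℝ) ∞ N]
    (γ : N → M) (hγ : Manifold.IsSmoothEmbedding 𝓘(ℝ, ℝ) 𝓘(ℝ, E) ∞ γ)
    (o : ∀ s : N, TangentSpace 𝓘(ℝ, ℝ) s) (ho : IsVelocityField o)
    (g : PseudoRiemannianMetric E M) (hg : g ∈ c.metrics) :
    (IsOrientedNullGeodesic g γ o ↔ ∃ S : BitractorAlong c γ, IsIncidentParallel c γ S) ∧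
    (IsOrientedNullGeodesic g γ o →
      (∃ S : BitractorAlong c γ, IsIncidentParallel c γ S ∧ IsCompatible c γ o S) ∧
      (∀ S : BitractorAlong c γ, IsIncidentParallel c γ S →
        IsTotallyNull c γ S ∧ (IsCompatible c γ o S ∨ IsCompatible c γ o (-S))) ∧
      (∀ S S' : BitractorAlong c γ, IsIncidentParallel c γ S → IsIncidentParallel c γ S' →
        IsCompatible c γ o S → IsCompatible c γ o S' →
        ∃ r : ℝ, 0 < r ∧ S' = r • S)) := by
  have : Nontrivial E := Module.nontrivial_of_finrank_pos (R := ℝ) (by omega)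
  obtain ⟨s₁⟩ : Nonempty N := inferInstance
  have hγs := hγ.contMDiff
  have hinj : ∀ s, Function.Injective (pushforward (E := E) γ s) := fun s ↦
    mfderiv_injective_of_isImmersionAt (hγ.isImmersion.isImmersionAt s)
  have hexists : IsOrientedNullGeodesic g γ o →
      ∃ S : BitractorAlong c γ, IsIncidentParallel c γ S ∧ IsCompatible c γ o S := by
    intro h
    obtain ⟨V, hV, hV₀, hVo⟩ := h.exists_isNullParallelField
    obtain ⟨S, hS⟩ := exists_hasLeg c γ ⟨g, hg⟩ V
    exact ⟨S, hS.isIncidentParallel hγs hinj hV (hV₀ s₁), hS.isCompatible hVo⟩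
  refine ⟨⟨fun h ↦ ?_, fun ⟨S, hS⟩ ↦ hS.isOrientedNullGeodesic hγs hinj ho ⟨g, hg⟩⟩,
    fun h ↦ ⟨hexists h, ?_⟩⟩
  · obtain ⟨S, hS, -⟩ := hexists h
    exact ⟨S, hS⟩
  obtain ⟨W, hW, hW₀, hWo⟩ := h.exists_isNullParallelField
  obtain ⟨S₀, hS₀⟩ := exists_hasLeg c γ ⟨g, hg⟩ W
  -- All solutions are compared with one fixed oriented velocity `W`, so the remaining claims
  -- concern the sign of a single constant `r`.
  have hmultiple : ∀ S : BitractorAlong c γ, IsIncidentParallel c γ S →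
      ∃ r : ℝ, r ≠ 0 ∧ HasLeg S ⟨g, hg⟩ (fun s ↦ r • W s) := by
    intro S hS
    obtain ⟨f, -, hleg, hV⟩ := hS.exists_isNullParallelField hγs hinj ho ⟨g, hg⟩
    obtain ⟨r, hr⟩ := hV.exists_eq_smul hγs hinj hW hW₀
    obtain rfl | hr₀ := eq_or_ne r 0
    · exact absurd (hleg.eq_zero_of_forall fun s ↦ by rw [hr s, zero_smul]) hS.ne_zero
    · exact ⟨r, hr₀, funext hr ▸ hleg⟩
  refine ⟨fun S hS ↦ ?_, fun S S' hS hS' hSo hSo' ↦ ?_⟩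
  · obtain ⟨r, hr, hleg⟩ := hmultiple S hS
    refine ⟨hleg.isTotallyNull fun s ↦ (hW.const_smul hγs r).null s _, ?_⟩
    have hcompat : ∀ {T : BitractorAlong c γ} {q : ℝ}, 0 < q →
        HasLeg T ⟨g, hg⟩ (fun s ↦ q • W s) → IsCompatible c γ o T := by
      intro T q hq hT
      refine hT.isCompatible fun s ↦ ?_
      obtain ⟨a, ha, has⟩ := hWo s
      exact ⟨q * a, mul_pos hq ha, by rw [has, smul_smul]⟩
    rcases hr.lt_or_gt with hneg | hpos
    · refine Or.inr (hcompat (neg_pos.2 hneg) ?_)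
      have := hleg.smul (-1)
      simpa only [neg_smul, one_smul] using this
    · exact Or.inl (hcompat hpos hleg)
  · obtain ⟨r, hr, hleg⟩ := hmultiple S hS
    obtain ⟨r', hr', hleg'⟩ := hmultiple S' hS'
    have hSS' : S' = (r' / r) • S := by
      refine hleg'.eq ?_
      have := hleg.smul (r' / r)
      simpa only [smul_smul, div_mul_cancel₀ r' hr] using this
    refine ⟨r' / r, ?_, hSS'⟩
    -- The ratio is a global constant, so its sign can be tested at one point: there `(r' / r) a =
    -- a'` with `a` and `a'` positive.
    obtain ⟨a, ha, hSa⟩ := hSo ⟨g, hg⟩ s₁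
    obtain ⟨a', ha', hSa'⟩ := hSo' ⟨g, hg⟩ s₁
    have hne := wedge_ne_zero (E := E) (μ := pushforward γ s₁ (o s₁)) fun h ↦
      ho.2 s₁ (hinj s₁ (h.trans (map_zero _).symm))
    rw [hSS', Pi.smul_apply, map_smul, hSa, smul_smul] at hSa'
    have := smul_left_injective ℝ hne hSa'
    exact pos_of_mul_pos_left (this ▸ ha') ha.le
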